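/- **Setting.** Fix $N$. All skew Schur functions $s_{\lambda/\mu}=s_{\lambda/\mu}(x_1,\dots,x_N)=\sum_T\prod_{k=1}^N x_k^{m(T,k)}$ are generating functions of the semistandard skew tableaux $T$ of shape $\lambda/\mu$ with entries in $\{1,\dots,N\}$, where $m(T,k)$ is the number of entries $k$ in $T$. For a skew shape $\lambda/\mu$, a shift $t\in\mathbb Z$ and a number $r\ge\ell(\lambda)$ of rows, the starting points are $(\mu_i-i+t,1)$ and the ending points are $(\lambda_i-i+t,N)$, $1\le i\le r$. A skew shape *corresponds* to a set of starting/ending points if these are its starting/ending points for some $r$ and some shift. A family of nonintersecting lattice paths consists of pairwise disjoint paths in $\mathbb Z^2$ with unit steps to the right and upwards, the $i$-th path (counted from right to left) leading from the $i$-th starting point to the $i$-th ending point. Let $\lambda/\mu$ and $\sigma/\tau$ be skew shapes and $t\in\mathbb Z$. Colour the starting/ending points of $\lambda/\mu$ with shift $0$ and $r=\ell(\lambda)$ white, and those of $\sigma/\tau$ with shift $t$ and $r=\ell(\sigma)$ black; starting points are always distinguished from ending points. Points with exactly one colour are called *coloured*, points with both colours *doubled*. Forgetting which colour the coloured points have gives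 the *configuration* $K$. An *orientation* marks each coloured point as inward or outward; it assigns colours to the coloured points: inward ending points and outward starting points are white, the other coloured points are black (doubled points keep both colours). An orientation is *admissible* if it has as many inward as outward points. An *overlay* for $(K,v)$ is a pair $(P_1,P_2)$ of families of nonintersecting lattice paths, for the white and for the black points determined by $v$. Given an overlay, prolong every path by a vertical arc below its starting point and a vertical arc above its ending point; these two arcs stand for the starting and the ending point. An arc is *coloured* if it belongs to exactly one of the two families. The *bicoloured path* starting at a coloured point $q$ begins with the arc standing for $q$ and follows coloured arcs: at a lattice point lying on one path only, it continues along this path in the same direction (right/up or left/down); at a lattice point where a white and a black path meet, it changes to the other path and reverses its direction; it stops if it cannot be continued. Its end points are coloured points. *Recolouring* it exchanges black and white for all its arcs and for both of its end points. **Lemma.** Let $S$ be a nonempty set of coloured points which are inward in the orientation given by the colouring for $(\lambda/\mu,\sigma/\tau)$ itself. Let $G$ be the graph whose vertex set $V$ is the set of all admissible orientations, where $v_1,v_2$ are adjacent if and only if there are overlays $(P_1,P_2)$ for $(K,v_1)$ and $(P_1',P_2')$ for $(K,v_2)$ such that $(P_1',P_2')$ is obtained from $(P_1,P_2)$ by recolouring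 all bicoloured paths incident with some point of $S$. Then $G$ is bipartite. Moreover, let $V=E\cup O$, $E\cap O=\emptyset$, be any bipartition of $G$ (no edge connects two vertices of $E$ or two vertices of $O$), and let $C$ be any connected component of $G$ with at least two vertices. Then for every $x\in C$ there is a pair of skew shapes $(\lambda^x/\mu^x,\sigma^x/\tau^x)$ that correspond to the white and to the black points determined by $(K,x)$, respectively, and for any choice of such pairs, $$\sum_{x\in C\cap E}s_{\lambda^x/\mu^x}\cdot s_{\sigma^x/\tau^x}=\sum_{x\in C\cap O}s_{\lambda^x/\mu^x}\cdot s_{\sigma^x/\tau^x}.$$ -/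

import Mathlib

namespace SkewOverlay

/-! ### Skew shapes and skew Schur functions -/

/-- A skew shape `outer / inner`: two partitions (given by their Ferrers diagrams) with
`inner_i ≤ outer_i` for all `i`. -/
structure SkewShape where
  outer : YoungDiagram
  inner : YoungDiagram
  le : inner ≤ outer

namespace SkewShape

/-- The skew Ferrers diagram; cells are pairs (row, column). -/
def cells (α : SkewShape) : Finset (ℕ × ℕ) := α.outer.cells \ α.inner.cells

/-- The length of the outer partition (its number of positive parts). -/
def length (α : SkewShape) : ℕ := α.outer.colLen 0

/-- A filling of the cells with `N` letters (`Fin N` stands for `{1, …, N}`) is semistandard if it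
weakly increases in rows and strictly increases in columns. -/
def IsSemistandard (α : SkewShape) (N : ℕ) (T : {c // c ∈ α.cells} → Fin N) : Prop :=
  (∀ c d, c.1.1 = d.1.1 → c.1.2 < d.1.2 → T c ≤ T d) ∧
    (∀ c d, c.1.2 = d.1.2 → c.1.1 < d.1.1 → T c < T d)

open Classical in
/-- The skew Schur function `s_{outer/inner}(x_1, …, x_N)`: the sum of the weights
`∏ k, x_k ^ m(T, k)` over all semistandard skew tableaux `T`, where `m(T, k)` is the number of
entries `k` in `T`. -/
noncomputable def schur (α : SkewShape) (N : ℕ) : MvPolynomial (Fin N) ℤ :=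
  ∑ T : {c // c ∈ α.cells} → Fin N with α.IsSemistandard N T,
    ∏ k : Fin N, MvPolynomial.X k ^ (Finset.univ.filter fun c => T c = k).card

end SkewShape

/-! ### Starting and ending points, configurations, orientations -/

/-- A starting point `(x, 1)` is `Sum.inl x`; an ending point `(x, N)` is `Sum.inr x`. -/
abbrev Point := ℤ ⊕ ℤ

/-- The starting points `(μ_i - i + t, 1)` and the ending points `(λ_i - i + t, N)`, `1 ≤ i ≤ r`, of
families of `r` lattice paths for the skew shape `λ/μ` with shift `t`
(`rowLen` counts rows from `0`). -/
def SkewShape.points (α : SkewShape) (r : ℕ) (t : ℤ) : Finset Point :=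
  ((Finset.range r).image fun i => (α.inner.rowLen i : ℤ) - (i + 1) + t).disjSum
    ((Finset.range r).image fun i => (α.outer.rowLen i : ℤ) - (i + 1) + t)

/-- The skew shape `α` corresponds to the set `Q` of starting/ending points: for some shift `t` and
some number `r` of rows (trailing rows may be empty), `Q` consists of the starting/ending points
of `α`. -/
def SkewShape.CorrespondsTo (α : SkewShape) (Q : Finset Point) : Prop :=
  ∃ (r : ℕ) (t : ℤ), α.length ≤ r ∧ α.points r t = Q

inductive Colour
  | white
  | black
  deriving DecidableEq

/-- Radial orientation of a point on the circle: towards the centre or away from it. -/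
inductive Radial
  | inward
  | outward
  deriving DecidableEq

instance : Fintype Radial := ⟨{Radial.inward, Radial.outward}, by rintro (_ | _) <;> simp⟩

/-- White means downwards and black means upwards; starting points lie on the lower half and ending
points on the upper half of the circle. So white ending points and black starting points are
oriented towards the centre, the other points away from it. -/
def radialOf : Point → Colour → Radial
  | Sum.inl _, Colour.white => Radial.outward
  | Sum.inl _, Colour.black => Radial.inward
  | Sum.inr _, Colour.white => Radial.inward
  | Sum.inr _, Colour.black => Radial.outward

/-- A configuration of starting/ending points: the points that carry both colours, and the points
that carry exactly one colour (the *coloured* points), without the information which colour. -/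
structure Configuration where
  doubled : Finset Point
  coloured : Finset Point

/-- White points: `α` with shift `0`. Black points: `β` with shift `t`. -/
def configuration (α β : SkewShape) (t : ℤ) : Configuration where
  doubled := α.points α.length 0 ∩ β.points β.length t
  coloured := symmDiff (α.points α.length 0) (β.points β.length t)

/-- A circular orientation of the coloured points of `K`. -/
abbrev Orientation (K : Configuration) := {q // q ∈ K.coloured} → Radial

/-- The orientation of the coloured points given by the pair `α, β` itself. -/
def initialOrientation (α β : SkewShape) (t : ℤ) : Orientation (configuration α β t) :=
  fun q => radialOf q.1
    (if q.1 ∈ α.points α.length 0 then Colour.white else Colour.black)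

/-- Admissible: as many points are oriented inwards as outwards. -/
def Admissible {K : Configuration} (v : Orientation K) : Prop :=
  (Finset.univ.filter fun q => v q = Radial.inward).card =
    (Finset.univ.filter fun q => v q = Radial.outward).card

/-- The set of all admissible orientations. -/
abbrev Vertices (K : Configuration) := {v : Orientation K // Admissible v}

/-- There are only finitely many admissible orientations, so sums over them make sense. -/
theorem vertices_finite (K : Configuration) : Finite (Vertices K) := inferInstance

/-- All points carrying the colour `c` when the coloured points are oriented according to `v`. -/
def Orientation.points {K : Configuration} (v : Orientation K) (c : Colour) : Finset Point :=
  K.doubled ∪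
    (Finset.univ.filter fun q : {q // q ∈ K.coloured} => radialOf q.1 c = v q).map
      (Function.Embedding.subtype _)

/-! ### Families of nonintersecting lattice paths -/

/-- An arc of the lattice, given by its tail and its head. -/
abbrev Arc := (ℤ × ℤ) × (ℤ × ℤ)

/-- The arcs of the lattice `ℤ²`: unit steps to the right or upwards. -/
def Step (u w : ℤ × ℤ) : Prop := w = (u.1 + 1, u.2) ∨ w = (u.1, u.2 + 1)

/-- `p` is the list of lattice points of a lattice path from `u` to `w`. -/
def IsLatticePath (u w : ℤ × ℤ) (p : List (ℤ × ℤ)) : Prop :=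
  p.IsChain Step ∧ p.head? = some u ∧ p.getLast? = some w

/-- A family of nonintersecting lattice paths with starting/ending points `Q`: the `i`-th path (from
right to left) leads from the `i`-th starting point to the `i`-th ending point. -/
structure PathFamily (N : ℕ) (Q : Finset Point) where
  r : ℕ
  start : Fin r → ℤ
  finish : Fin r → ℤ
  path : Fin r → List (ℤ × ℤ)
  start_anti : StrictAnti start
  finish_anti : StrictAnti finish
  mem_start : ∀ x, Sum.inl x ∈ Q ↔ ∃ i, start i = x
  mem_finish : ∀ x, Sum.inr x ∈ Q ↔ ∃ i, finish i = x
  isPath : ∀ i, IsLatticePath (start i, 1) (finish i, (N : ℤ)) (path i)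
  disjoint : ∀ i j, i ≠ j → (path i).Disjoint (path j)

/-- The lattice points on the paths of the family. -/
def PathFamily.vertices {N : ℕ} {Q : Finset Point} (F : PathFamily N Q) : Set (ℤ × ℤ) :=
  {u | ∃ i, u ∈ F.path i}

/-- The arcs on the paths of the family, where each path is prolonged by one vertical arc below its
starting point and one vertical arc above its ending point. These two additional arcs represent the
starting point and the ending point themselves, see `stub`. -/
def PathFamily.arcs {N : ℕ} {Q : Finset Point} (F : PathFamily N Q) : Set Arc :=
  {e | ∃ i, [e.1, e.2] <:+:
    ((F.start i, (0 : ℤ)) :: (F.path i ++ [(F.finish i, (N : ℤ) + 1)]))}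

/-- The vertical arc that represents a starting or ending point. -/
def stub (N : ℕ) : Point → Arc
  | Sum.inl x => ((x, 0), (x, 1))
  | Sum.inr x => ((x, (N : ℤ)), (x, (N : ℤ) + 1))

/-! ### Overlays, bicoloured paths, recolouring -/

/-- An overlay of a white and a black family of nonintersecting lattice paths for the
starting/ending points determined by the orientation `v`. -/
abbrev Overlay (N : ℕ) {K : Configuration} (v : Orientation K) :=
  (c : Colour) → PathFamily N (v.points c)

section

variable {N : ℕ} {K : Configuration} {v : Orientation K}

/-- The arc `e` carries the colour `c` and no other colour. -/
def HasOnlyColour (P : Overlay N v) (c : Colour) (e : Arc) : Prop :=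
  ∀ d, e ∈ (P d).arcs ↔ d = c

/-- A white and a black path meet in the lattice point `u`. -/
def Meet (P : Overlay N v) (u : ℤ × ℤ) : Prop := ∀ c, u ∈ (P c).vertices

/-- The coloured arcs `e` and `f` are consecutive on a bicoloured path. They share a lattice point
`u`. If no other path is met in `u`, then we stay on the same path and keep our direction
(one of the arcs enters `u`, the other one leaves `u`); if another path is met in `u`, then we
change to this path (of the other colour) and reverse the direction (both arcs enter `u`, or
both leave `u`). -/
def Consecutive (P : Overlay N v) (e f : Arc) : Prop :=
  ∃ (c d : Colour) (u : ℤ × ℤ), HasOnlyColour P c e ∧ HasOnlyColour P d f ∧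
    ((¬ Meet P u ∧ c = d ∧ ((e.2 = u ∧ f.1 = u) ∨ (e.1 = u ∧ f.2 = u))) ∨
      (Meet P u ∧ c ≠ d ∧ ((e.2 = u ∧ f.2 = u) ∨ (e.1 = u ∧ f.1 = u))))

/-- The arcs of the bicoloured path that starts at the coloured point `q` (including the arcs
that represent its two end points). -/
def bicolouredPath (P : Overlay N v) (q : Point) : Set Arc :=
  {e | Relation.ReflTransGen (Consecutive P) (stub N q) e}

/-- The overlay `P'` is obtained from the overlay `P` by recolouring all bicoloured paths that are
incident with some point of `S`. As the arcs representing the starting/ending points are included,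
this recolours the end points of these bicoloured paths, too. -/
def IsRecolouring {w : Orientation K} (S : Set {q // q ∈ K.coloured})
    (P : Overlay N v) (P' : Overlay N w) : Prop :=
  ∀ c, (P' c).arcs = symmDiff (P c).arcs (⋃ q ∈ S, bicolouredPath P q.1)

end

/-- The graph on all admissible orientations, where two orientations are adjacent if recolouring all
bicoloured paths incident with `S` leads from some overlay for one of them to some overlay for the
other one. -/
def recolouringGraph (N : ℕ) (K : Configuration) (S : Set {q // q ∈ K.coloured}) :
    SimpleGraph (Vertices K) :=
  SimpleGraph.fromRel fun v w =>
    ∃ (P : Overlay N v.1) (P' : Overlay N w.1), IsRecolouring S P P'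

/-- The pair of skew shapes `ρ` corresponds to the starting/ending points determined by `v`:
`ρ.1` to the white points and `ρ.2` to the black points. -/
def CorrespondingPair {K : Configuration} (v : Orientation K) (ρ : SkewShape × SkewShape) : Prop :=
  ρ.1.CorrespondsTo (v.points Colour.white) ∧ ρ.2.CorrespondsTo (v.points Colour.black)

end SkewOverlay

namespace SkewOverlay

/-! Recolouring is a weight-preserving involution on overlays, and it moves along the edges of the
graph.

A family of nonintersecting paths is determined by its set of arcs. Such sets are exactly the flows:
at most one arc enters and one leaves each lattice point, and conservation holds at the heights `1,
…, N`. One direction is `PathFamily.isFlowOn_arcs`; the other, for `1 ≤ N`, is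
`IsFlowOn.exists_pathFamily`. These conditions are local, so they can be checked point by point
after exchanging colours.

For an overlay, let `U` and `I` be the union and the intersection of its two arc sets. The pairing
of consecutive coloured arcs depends only on `U` and `I` (`consecutive_iff`). Exchanging the colours
on a set of coloured arcs closed under the pairing gives two flows again (`isFlow_exchange`) and
leaves `U` and `I` unchanged. So the bicoloured paths are the same before and after, and recolouring
twice is the identity (`recolour_recolour`). The product of the two weights is the weight of `U`
times that of `I`, hence it is preserved as well (`weight_recolour`).

Recolouring reverses the orientation of every point of `S`. One fixed point of `S` therefore gives a
bipartition of the graph. The new orientation is admissible, because each of the two new families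
has as many starting as ending points (`admissible_of_sum_eq_zero`).

Semistandard tableaux correspond bijectively to flows with the given starting and ending points, and
weights agree (`SkewShape.CorrespondsTo.schur_eq`). A product of two skew Schur functions is thus
the generating function of the overlays of an orientation. Within a component, recolouring is a
bijection between the overlays over `E` and those over `O`, which gives the identity
(`sum_schur_eq`). -/

/-! ### Flows: sets of arcs that decompose into disjoint lattice paths -/

/-- The vertical arc from `(x, k)` to `(x, k + 1)`. -/
def vert (x k : ℤ) : Arc := ((x, k), (x, k + 1))

/-- The horizontal arc from `(x, k)` to `(x + 1, k)`. -/
def hor (x k : ℤ) : Arc := ((x, k), (x + 1, k))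

/-- Finite sets of arcs in the strip between the heights `0` and `N + 1` with at most one arc
entering and at most one arc leaving each lattice point, such that each point with height in
`{1, …, N}` is entered if and only if it is left. -/
structure IsFlow (N : ℕ) (A : Set Arc) : Prop where
  finite : A.Finite
  mem_cases : ∀ e ∈ A, (∃ x k : ℤ, 0 ≤ k ∧ k ≤ N ∧ e = vert x k) ∨
    ∃ x k : ℤ, 1 ≤ k ∧ k ≤ N ∧ e = hor x k
  head_inj : ∀ e ∈ A, ∀ f ∈ A, e.2 = f.2 → e = f
  tail_inj : ∀ e ∈ A, ∀ f ∈ A, e.1 = f.1 → e = f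
  out_of_in : ∀ e ∈ A, e.2.2 ≤ N → ∃ f ∈ A, f.1 = e.2
  in_of_out : ∀ e ∈ A, 1 ≤ e.1.2 → ∃ f ∈ A, f.2 = e.1

theorem IsFlow.one_le_head {N : ℕ} {A : Set Arc} (h : IsFlow N A) {e : Arc} (he : e ∈ A) :
    1 ≤ e.2.2 := by
  rcases h.mem_cases e he with ⟨x, k, h0, h1, rfl⟩ | ⟨x, k, h0, h1, rfl⟩ <;>
    simp only [vert, hor] <;> omega

theorem IsFlow.tail_le {N : ℕ} {A : Set Arc} (h : IsFlow N A) {e : Arc} (he : e ∈ A) :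
    e.1.2 ≤ N := by
  rcases h.mem_cases e he with ⟨x, k, h0, h1, rfl⟩ | ⟨x, k, h0, h1, rfl⟩ <;>
    simp only [vert, hor] <;> omega

/-- `A` is a flow that starts and ends in the points `Q`. -/
structure IsFlowOn (N : ℕ) (Q : Finset Point) (A : Set Arc) : Prop extends IsFlow N A where
  stub_mem : ∀ q, stub N q ∈ A ↔ q ∈ Q

/-! ### Recolouring pairs of flows -/

/-- The arcs carrying some colour. -/
def allArcs (A : Colour → Set Arc) : Set Arc := {e | ∃ c, e ∈ A c}

/-- The arcs carrying both colours. -/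
def commonArcs (A : Colour → Set Arc) : Set Arc := {e | ∀ c, e ∈ A c}

/-- A white and a black path meet in `u`, in terms of the set `U` of all arcs and the set `I` of
common arcs. -/
def MeetAt (N : ℕ) (U I : Set Arc) (u : ℤ × ℤ) : Prop :=
  u.2 ≤ N ∧ ((∃ e ∈ U, ∃ f ∈ U, e ≠ f ∧ e.2 = u ∧ f.2 = u) ∨ ∃ e ∈ I, e.2 = u)

/-- Consecutive arcs of bicoloured paths, in terms of the set `U` of all arcs and the set `I` of
common arcs. -/
def Linked (N : ℕ) (U I : Set Arc) (e f : Arc) : Prop :=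
  (e ∈ U ∧ e ∉ I) ∧ (f ∈ U ∧ f ∉ I) ∧ ∃ u,
    (¬ MeetAt N U I u ∧ ((e.2 = u ∧ f.1 = u) ∨ (e.1 = u ∧ f.2 = u))) ∨
    (MeetAt N U I u ∧ e ≠ f ∧ ((e.2 = u ∧ f.2 = u) ∨ (e.1 = u ∧ f.1 = u)))

theorem Linked.symm {N : ℕ} {U I : Set Arc} {e f : Arc} (h : Linked N U I e f) :
    Linked N U I f e := by
  obtain ⟨he, hf, u, h⟩ := h
  refine ⟨hf, he, u, ?_⟩
  tauto

def Colour.other : Colour → Colour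
  | .white => .black
  | .black => .white

theorem Colour.eq_or_eq_other (c d : Colour) : d = c ∨ d = c.other := by
  cases c <;> cases d <;> simp [Colour.other]

theorem Colour.other_ne (c : Colour) : c.other ≠ c := by cases c <;> simp [Colour.other]

theorem mem_allArcs {A : Colour → Set Arc} (c : Colour) {e : Arc} :
    e ∈ allArcs A ↔ e ∈ A c ∨ e ∈ A c.other := by
  constructor
  · rintro ⟨d, h⟩
    rcases c.eq_or_eq_other d with rfl | rfl <;> simp [h]
  · rintro (h | h) <;> exact ⟨_, h⟩

theorem mem_commonArcs {A : Colour → Set Arc} (c : Colour) {e : Arc} :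
    e ∈ commonArcs A ↔ e ∈ A c ∧ e ∈ A c.other := by
  constructor
  · exact fun h => ⟨h _, h _⟩
  · rintro ⟨h, h'⟩ d
    rcases c.eq_or_eq_other d with rfl | rfl <;> assumption

/-- Two different arcs entering `u` cannot belong to the same flow, so each colour supplies one of
them; a common arc supplies both colours at once. Conservation then yields the outgoing arcs. The
height bound excludes the upper ends of the arcs that stand for ending points. -/
theorem meetAt_iff {N : ℕ} {A : Colour → Set Arc} (hA : ∀ c, IsFlow N (A c)) (u : ℤ × ℤ) :
    MeetAt N (allArcs A) (commonArcs A) u ↔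
      ∀ c, (∃ e ∈ A c, e.2 = u) ∧ ∃ e ∈ A c, e.1 = u := by
  constructor
  · rintro ⟨hu, h⟩
    suffices H : ∀ c, ∃ e ∈ A c, e.2 = u by
      intro c
      refine ⟨H c, ?_⟩
      obtain ⟨e, he, rfl⟩ := H c
      exact (hA c).out_of_in e he hu
    intro c
    rcases h with ⟨e, he, f, hf, hne, h1, h2⟩ | ⟨e, he, h⟩
    · rw [mem_allArcs c] at he hf
      have := (hA c.other).head_inj e
      grind
    · exact ⟨e, he c, h⟩
  · intro h
    refine ⟨?_, ?_⟩
    · obtain ⟨-, e, he, rfl⟩ := h .white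
      exact (hA _).tail_le he
    · obtain ⟨⟨e, he, h1⟩, -⟩ := h .white
      obtain ⟨⟨f, hf, h2⟩, -⟩ := h .black
      by_cases hef : e = f
      · subst hef
        exact .inr ⟨e, (mem_commonArcs .white).2 ⟨he, hf⟩, h1⟩
      · exact .inl ⟨e, ⟨_, he⟩, f, ⟨_, hf⟩, hef, h1, h2⟩

/-- The local rule: if the set `X` of exchanged arcs is compatible with the pairing of the coloured
arcs at a lattice point `u`, then the exchange preserves the conservation law at `u`. -/
theorem exists_mem_symmDiff {α β : Type*} {A B X : Set α} {p q : α → β} {u : β} {M : Prop}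
    (hA : (∃ e ∈ A, p e = u) → ∃ f ∈ A, q f = u) (hB : (∃ e ∈ B, p e = u) → ∃ f ∈ B, q f = u)
    (hX : ∀ e ∈ X, (e ∈ A ∨ e ∈ B) ∧ ¬ (e ∈ A ∧ e ∈ B))
    (hqA : ∀ e ∈ A, ∀ f ∈ A, q e = u → q f = u → e = f)
    (hM : M ↔ (∃ f ∈ A, q f = u) ∧ ∃ f ∈ B, q f = u)
    (hpq : ¬ M → ∀ e f, (e ∈ A ∨ e ∈ B) ∧ ¬ (e ∈ A ∧ e ∈ B) → (f ∈ A ∨ f ∈ B) ∧ ¬ (f ∈ A ∧ f ∈ B) →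
      p e = u → q f = u → (e ∈ X ↔ f ∈ X))
    (hqq : M → ∀ e f, (e ∈ A ∨ e ∈ B) ∧ ¬ (e ∈ A ∧ e ∈ B) → (f ∈ A ∨ f ∈ B) ∧ ¬ (f ∈ A ∧ f ∈ B) →
      e ≠ f → q e = u → q f = u → (e ∈ X ↔ f ∈ X))
    (h : ∃ e ∈ symmDiff A X, p e = u) : ∃ f ∈ symmDiff A X, q f = u := by
  simp only [Set.mem_symmDiff] at h ⊢
  obtain ⟨e, he | he, hu⟩ := h
  · obtain ⟨f, hf, hfu⟩ := hA ⟨e, he.1, hu⟩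
    by_cases hfX : f ∈ X
    · have hfc := hX f hfX
      -- The arc `f` leaves `A`. At a meeting point its partner `g` in `B` is exchanged as well and
      -- replaces it; elsewhere `e` is paired with `f`, against `e ∉ X`.
      by_cases m : M
      · obtain ⟨g, hg, hgu⟩ := (hM.1 m).2
        have hgf : f ≠ g := fun h => hfc.2 ⟨hf, h ▸ hg⟩
        have hgA : g ∉ A := fun h => hgf (hqA f hf g h hfu hgu)
        exact ⟨g, .inr ⟨(hqq m f g hfc ⟨.inr hg, fun h => hgA h.1⟩ hgf hfu hgu).1 hfX, hgA⟩, hgu⟩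
      · exfalso
        have heB : e ∉ B := fun h => m (hM.2 ⟨⟨f, hf, hfu⟩, hB ⟨e, h, hu⟩⟩)
        exact he.2 ((hpq m e f ⟨.inl he.1, fun h => heB h.2⟩ hfc hu hfu).2 hfX)
    · exact ⟨f, .inl ⟨hf, hfX⟩, hfu⟩
  · have hec := hX e he.1
    have heB : e ∈ B := hec.1.resolve_left he.2
    obtain ⟨f, hf, hfu⟩ := hB ⟨e, heB, hu⟩
    by_cases hfX : f ∈ X
    · exact ⟨f, .inr ⟨hfX, fun h => (hX f hfX).2 ⟨h, hf⟩⟩, hfu⟩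
    · by_cases hfA : f ∈ A
      · exact ⟨f, .inl ⟨hfA, hfX⟩, hfu⟩
      · have hfc : (f ∈ A ∨ f ∈ B) ∧ ¬ (f ∈ A ∧ f ∈ B) := ⟨.inr hf, fun h => hfA h.1⟩
        -- The arc `f` does not enter `A`. At a meeting point its partner `g` in `A` then stays
        -- there; elsewhere `e` is paired with `f`, and `e ∈ X` forces `f ∈ X`.
        by_cases m : M
        · obtain ⟨g, hg, hgu⟩ := (hM.1 m).1
          have hgf : g ≠ f := fun h => hfA (h ▸ hg)
          refine ⟨g, .inl ⟨hg, fun hgX => hfX ?_⟩, hgu⟩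
          exact (hqq m g f (hX g hgX) hfc hgf hgu hfu).1 hgX
        · exact absurd ((hpq m e f hec hfc hu hfu).1 he.1) hfX

/-- If `X` is compatible with the pairing of coloured arcs, then the exchange preserves the
property that at most one arc is incident with `u` in the given direction. -/
theorem eq_of_mem_symmDiff {α β : Type*} {A B X : Set α} {p : α → β} {u : β}
    (hX : ∀ e ∈ X, (e ∈ A ∨ e ∈ B) ∧ ¬ (e ∈ A ∧ e ∈ B))
    (hA : ∀ e ∈ A, ∀ f ∈ A, p e = u → p f = u → e = f)
    (hB : ∀ e ∈ B, ∀ f ∈ B, p e = u → p f = u → e = f)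
    (hAB : ∀ e f, e ∈ A → f ∈ B → (e ∈ A ∨ e ∈ B) ∧ ¬ (e ∈ A ∧ e ∈ B) →
      (f ∈ A ∨ f ∈ B) ∧ ¬ (f ∈ A ∧ f ∈ B) → e ≠ f → p e = u → p f = u → (e ∈ X ↔ f ∈ X)) :
    ∀ e ∈ symmDiff A X, ∀ f ∈ symmDiff A X, p e = u → p f = u → e = f := by
  have key : ∀ e f, e ∈ A → e ∉ X → f ∈ X → f ∉ A → p e = u → p f = u → e = f := by
    intro e f he heX hfX hfA hue huf
    by_contra hne
    have hfc := hX f hfX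
    have hfB := hfc.1.resolve_left hfA
    by_cases heB : e ∈ B
    · exact hne (hB e heB f hfB hue huf)
    · exact heX ((hAB e f he hfB ⟨.inl he, fun h => heB h.2⟩ hfc hne hue huf).2 hfX)
  simp only [Set.mem_symmDiff]
  rintro e (he | he) f (hf | hf) hue huf
  · exact hA e he.1 f hf.1 hue huf
  · exact key e f he.1 he.2 hf.1 hf.2 hue huf
  · exact (key f e hf.1 hf.2 he.1 he.2 huf hue).symm
  · exact hB e ((hX e he.1).1.resolve_left he.2) f ((hX f hf.1).1.resolve_left hf.2) hue huf

/-! ### Recolouring as a weight-preserving involution -/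

section

variable {N : ℕ} {A : Colour → Set Arc} {X : Set Arc}

/-- Exchange the colours of the arcs in `X`. -/
def exchange (A : Colour → Set Arc) (X : Set Arc) : Colour → Set Arc := fun c => symmDiff (A c) X

theorem allArcs_exchange (hX : ∀ e ∈ X, e ∈ allArcs A ∧ e ∉ commonArcs A) :
    allArcs (exchange A X) = allArcs A := by
  ext e
  have := hX e
  rw [mem_allArcs .white, mem_allArcs .white]
  rw [mem_allArcs .white, mem_commonArcs .white] at this
  simp only [exchange, Set.mem_symmDiff]
  tauto

theorem commonArcs_exchange (hX : ∀ e ∈ X, e ∈ allArcs A ∧ e ∉ commonArcs A) :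
    commonArcs (exchange A X) = commonArcs A := by
  ext e
  have := hX e
  rw [mem_commonArcs .white, mem_commonArcs .white]
  rw [mem_allArcs .white, mem_commonArcs .white] at this
  simp only [exchange, Set.mem_symmDiff]
  tauto

/-- Each flow axiom concerns one lattice point. At a meeting point `X` contains both or neither of
two coloured arcs entering `u`, and likewise for leaving arcs; at any other point it contains both
or neither of the coloured arcs through `u`. So both local rules `exists_mem_symmDiff` and
`eq_of_mem_symmDiff` apply. -/
theorem isFlow_exchange (hA : ∀ c, IsFlow N (A c))
    (hX : ∀ e ∈ X, e ∈ allArcs A ∧ e ∉ commonArcs A)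
    (hcl : ∀ e ∈ X, ∀ f, Linked N (allArcs A) (commonArcs A) e f → f ∈ X) (c : Colour) :
    IsFlow N (exchange A X c) := by
  have hiff : ∀ e f, Linked N (allArcs A) (commonArcs A) e f → (e ∈ X ↔ f ∈ X) :=
    fun e f h => ⟨fun he => hcl e he f h, fun hf => hcl f hf e h.symm⟩
  have hX' : ∀ e ∈ X, (e ∈ A c ∨ e ∈ A c.other) ∧ ¬ (e ∈ A c ∧ e ∈ A c.other) := by
    intro e he
    rw [← mem_allArcs, ← mem_commonArcs]
    exact hX e he
  have hsub : ∀ e ∈ exchange A X c, e ∈ A c ∨ e ∈ A c.other := by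
    intro e he
    have := hX' e
    simp only [exchange, Set.mem_symmDiff] at he
    tauto
  have hmeet : ∀ u : ℤ × ℤ, MeetAt N (allArcs A) (commonArcs A) u ↔
      ((∃ e ∈ A c, e.2 = u) ∧ ∃ e ∈ A c, e.1 = u) ∧
        ((∃ e ∈ A c.other, e.2 = u) ∧ ∃ e ∈ A c.other, e.1 = u) := by
    intro u
    rw [meetAt_iff hA]
    constructor
    · exact fun h => ⟨h _, h _⟩
    · rintro ⟨h, h'⟩ d
      rcases c.eq_or_eq_other d with rfl | rfl <;> assumption
  -- By conservation, incoming arcs of both colours already make a meeting point if the height is at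
  -- most `N`; dually, outgoing arcs suffice from height `1` on.
  have hin : ∀ u : ℤ × ℤ, u.2 ≤ N → (MeetAt N (allArcs A) (commonArcs A) u ↔
      (∃ e ∈ A c, e.2 = u) ∧ ∃ e ∈ A c.other, e.2 = u) := by
    intro u hu
    rw [hmeet]
    constructor
    · exact fun h => ⟨h.1.1, h.2.1⟩
    · rintro ⟨⟨e, he, rfl⟩, ⟨f, hf, hfe⟩⟩
      refine ⟨⟨⟨e, he, rfl⟩, (hA c).out_of_in e he hu⟩, ⟨f, hf, hfe⟩, ?_⟩
      rw [← hfe] at hu ⊢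
      exact (hA _).out_of_in f hf hu
  have hout : ∀ u : ℤ × ℤ, 1 ≤ u.2 → (MeetAt N (allArcs A) (commonArcs A) u ↔
      (∃ e ∈ A c, e.1 = u) ∧ ∃ e ∈ A c.other, e.1 = u) := by
    intro u hu
    rw [hmeet]
    constructor
    · exact fun h => ⟨h.1.2, h.2.2⟩
    · rintro ⟨⟨e, he, rfl⟩, ⟨f, hf, hfe⟩⟩
      refine ⟨⟨(hA c).in_of_out e he hu, ⟨e, he, rfl⟩⟩, ?_, ⟨f, hf, hfe⟩⟩
      rw [← hfe] at hu ⊢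
      exact (hA _).in_of_out f hf hu
  have hcase : ∀ e ∈ exchange A X c, (∃ x k : ℤ, 0 ≤ k ∧ k ≤ N ∧ e = vert x k) ∨
      ∃ x k : ℤ, 1 ≤ k ∧ k ≤ N ∧ e = hor x k := by
    intro e he
    rcases hsub e he with h | h
    · exact (hA _).mem_cases e h
    · exact (hA _).mem_cases e h
  refine ⟨?_, hcase, ?_, ?_, ?_, ?_⟩
  · exact ((hA c).finite.union (hA c.other).finite).subset hsub
  · intro e he f hf hef
    by_cases hu : f.2.2 ≤ N
    · refine eq_of_mem_symmDiff (B := A c.other) (p := fun e => e.2) (u := f.2) hX' ?_ ?_ ?_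
        e he f hf hef rfl
      · exact fun f hf g hg h1 h2 => (hA c).head_inj f hf g hg (h1.trans h2.symm)
      · exact fun f hf g hg h1 h2 => (hA _).head_inj f hf g hg (h1.trans h2.symm)
      · intro g g' hg hg' hgc hgc' hne h1 h2
        rw [← mem_allArcs, ← mem_commonArcs] at hgc hgc'
        exact hiff _ _ ⟨hgc, hgc', _, .inr ⟨(hin _ hu).2 ⟨⟨g, hg, h1⟩, g', hg', h2⟩, hne,
          .inl ⟨h1, h2⟩⟩⟩
    -- At height `N + 1` nothing is paired, but only a vertical arc can end there, so the head
    -- determines the arc.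
    · have H : ∀ e ∈ exchange A X c, ¬ e.2.2 ≤ N → e = vert e.2.1 N := by
        intro e he hu
        rcases hcase e he with ⟨x, k, h0, h1, rfl⟩ | ⟨x, k, h0, h1, rfl⟩ <;>
          simp only [vert, hor] at hu ⊢
        · obtain rfl : k = N := by omega
          rfl
        · omega
      rw [H e he (hef ▸ hu), H f hf hu, hef]
  · intro e he f hf hef
    by_cases hu : 1 ≤ f.1.2
    · refine eq_of_mem_symmDiff (B := A c.other) (p := fun e => e.1) (u := f.1) hX' ?_ ?_ ?_
        e he f hf hef rfl
      · exact fun f hf g hg h1 h2 => (hA c).tail_inj f hf g hg (h1.trans h2.symm)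
      · exact fun f hf g hg h1 h2 => (hA _).tail_inj f hf g hg (h1.trans h2.symm)
      · intro g g' hg hg' hgc hgc' hne h1 h2
        rw [← mem_allArcs, ← mem_commonArcs] at hgc hgc'
        exact hiff _ _ ⟨hgc, hgc', _, .inr ⟨(hout _ hu).2 ⟨⟨g, hg, h1⟩, g', hg', h2⟩, hne,
          .inr ⟨h1, h2⟩⟩⟩
    -- Likewise, only a vertical arc can start at height `0`.
    · have H : ∀ e ∈ exchange A X c, ¬ 1 ≤ e.1.2 → e = vert e.1.1 0 := by
        intro e he hu
        rcases hcase e he with ⟨x, k, h0, h1, rfl⟩ | ⟨x, k, h0, h1, rfl⟩ <;>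
          simp only [vert, hor] at hu ⊢
        · obtain rfl : k = 0 := by omega
          rfl
        · omega
      rw [H e he (hef ▸ hu), H f hf hu, hef]
  · intro e he hu
    have hu' : 1 ≤ e.2.2 := by
      rcases hsub e he with h | h
      · exact (hA _).one_le_head h
      · exact (hA _).one_le_head h
    refine exists_mem_symmDiff (B := A c.other) (p := fun e => e.2) (q := fun e => e.1)
      ?_ ?_ hX' ?_ (hout _ hu') ?_ ?_ ⟨e, he, rfl⟩
    · rintro ⟨f, hf, h⟩
      rw [← h] at hu ⊢
      exact (hA c).out_of_in f hf hu
    · rintro ⟨f, hf, h⟩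
      rw [← h] at hu ⊢
      exact (hA c.other).out_of_in f hf hu
    · exact fun f hf g hg h1 h2 => (hA c).tail_inj f hf g hg (h1.trans h2.symm)
    · intro m f g hf hg h1 h2
      rw [← mem_allArcs, ← mem_commonArcs] at hf hg
      exact hiff _ _ ⟨hf, hg, _, .inl ⟨m, .inl ⟨h1, h2⟩⟩⟩
    · intro m f g hf hg hne h1 h2
      rw [← mem_allArcs, ← mem_commonArcs] at hf hg
      exact hiff _ _ ⟨hf, hg, _, .inr ⟨m, hne, .inr ⟨h1, h2⟩⟩⟩
  · intro e he hu
    have hu' : e.1.2 ≤ N := by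
      rcases hsub e he with h | h
      · exact (hA _).tail_le h
      · exact (hA _).tail_le h
    refine exists_mem_symmDiff (B := A c.other) (p := fun e => e.1) (q := fun e => e.2)
      ?_ ?_ hX' ?_ (hin _ hu') ?_ ?_ ⟨e, he, rfl⟩
    · rintro ⟨f, hf, h⟩
      rw [← h] at hu ⊢
      exact (hA c).in_of_out f hf hu
    · rintro ⟨f, hf, h⟩
      rw [← h] at hu ⊢
      exact (hA c.other).in_of_out f hf hu
    · exact fun f hf g hg h1 h2 => (hA c).head_inj f hf g hg (h1.trans h2.symm)
    · intro m f g hf hg h1 h2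
      rw [← mem_allArcs, ← mem_commonArcs] at hf hg
      exact hiff _ _ ⟨hf, hg, _, .inl ⟨m, .inr ⟨h1, h2⟩⟩⟩
    · intro m f g hf hg hne h1 h2
      rw [← mem_allArcs, ← mem_commonArcs] at hf hg
      exact hiff _ _ ⟨hf, hg, _, .inr ⟨m, hne, .inl ⟨h1, h2⟩⟩⟩

/-- The arcs on the bicoloured paths starting with one of the arcs in `Z`. -/
def linkedArcs (N : ℕ) (A : Colour → Set Arc) (Z : Set Arc) : Set Arc :=
  {f | ∃ e ∈ Z, Relation.ReflTransGen (Linked N (allArcs A) (commonArcs A)) e f}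

/-- Recolour all bicoloured paths starting with one of the arcs in `Z`. -/
def recolour (N : ℕ) (A : Colour → Set Arc) (Z : Set Arc) : Colour → Set Arc :=
  exchange A (linkedArcs N A Z)

variable {Z : Set Arc}

theorem linkedArcs_coloured (hZ : ∀ e ∈ Z, e ∈ allArcs A ∧ e ∉ commonArcs A) :
    ∀ e ∈ linkedArcs N A Z, e ∈ allArcs A ∧ e ∉ commonArcs A := by
  rintro f ⟨e, he, h⟩
  rcases Relation.ReflTransGen.cases_tail h with rfl | ⟨g, -, hg⟩
  · exact hZ _ he
  · exact hg.2.1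

theorem allArcs_recolour (hZ : ∀ e ∈ Z, e ∈ allArcs A ∧ e ∉ commonArcs A) :
    allArcs (recolour N A Z) = allArcs A := allArcs_exchange (linkedArcs_coloured hZ)

theorem commonArcs_recolour (hZ : ∀ e ∈ Z, e ∈ allArcs A ∧ e ∉ commonArcs A) :
    commonArcs (recolour N A Z) = commonArcs A := commonArcs_exchange (linkedArcs_coloured hZ)

theorem isFlow_recolour (hA : ∀ c, IsFlow N (A c))
    (hZ : ∀ e ∈ Z, e ∈ allArcs A ∧ e ∉ commonArcs A) (c : Colour) :
    IsFlow N (recolour N A Z c) := by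
  refine isFlow_exchange hA (linkedArcs_coloured hZ) ?_ c
  rintro f ⟨e, he, h⟩ g hg
  exact ⟨e, he, h.tail hg⟩

/-- The pairing sees only the union and the intersection of the two arc sets, which recolouring
keeps. The second recolouring thus exchanges the same arcs as the first. -/
theorem recolour_recolour (hZ : ∀ e ∈ Z, e ∈ allArcs A ∧ e ∉ commonArcs A) :
    recolour N (recolour N A Z) Z = A := by
  have h : linkedArcs N (recolour N A Z) Z = linkedArcs N A Z := by
    rw [linkedArcs, allArcs_recolour hZ, commonArcs_recolour hZ, linkedArcs]
  funext c
  rw [recolour, h, exchange, recolour, exchange, symmDiff_symmDiff_cancel_right]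

theorem mem_recolour_of_mem {e : Arc} (he : e ∈ Z) (c : Colour) : e ∈ recolour N A Z c ↔ e ∉ A c := by
  have : e ∈ linkedArcs N A Z := ⟨e, he, .refl⟩
  simp only [recolour, exchange, Set.mem_symmDiff]
  tauto

/-- The monomial of a family of paths: a horizontal arc at height `k` contributes `x_k`. -/
noncomputable def weight (N : ℕ) (A : Set Arc) : MvPolynomial (Fin N) ℤ :=
  ∏ k : Fin N, MvPolynomial.X k ^ (A ∩ {e | ∃ x, e = hor x ((k : ℤ) + 1)}).ncard

/-- Inclusion–exclusion for the numbers of horizontal arcs on each height. -/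
theorem weight_mul_weight (hA : ∀ c, IsFlow N (A c)) :
    weight N (A .white) * weight N (A .black) =
      weight N (allArcs A) * weight N (commonArcs A) := by
  simp only [weight, ← Finset.prod_mul_distrib, ← pow_add]
  refine Finset.prod_congr rfl fun k _ => ?_
  congr 1
  set H := {e | ∃ x, e = hor x ((k : ℤ) + 1)}
  have h1 : allArcs A ∩ H = (A .white ∩ H) ∪ (A .black ∩ H) := by
    ext e
    simp only [Set.mem_inter_iff, Set.mem_union, mem_allArcs .white, Colour.other]
    tauto
  have h2 : commonArcs A ∩ H = (A .white ∩ H) ∩ (A .black ∩ H) := by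
    ext e
    simp only [Set.mem_inter_iff, mem_commonArcs .white, Colour.other]
    tauto
  rw [h1, h2, Set.ncard_union_add_ncard_inter _ _ ((hA _).finite.inter_of_left _)
    ((hA _).finite.inter_of_left _)]

theorem weight_recolour (hA : ∀ c, IsFlow N (A c))
    (hZ : ∀ e ∈ Z, e ∈ allArcs A ∧ e ∉ commonArcs A) :
    weight N (recolour N A Z .white) * weight N (recolour N A Z .black) =
      weight N (A .white) * weight N (A .black) := by
  rw [weight_mul_weight hA, weight_mul_weight (isFlow_recolour hA hZ), allArcs_recolour hZ,
    commonArcs_recolour hZ]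

end

/-! ### The arcs of a family of paths form a flow -/

theorem pair_infix_iff {α : Type*} {a b : α} {l : List α} :
    [a, b] <:+: l ↔ ∃ n, l[n]? = some a ∧ l[n + 1]? = some b := by
  constructor
  · rintro ⟨s, t, rfl⟩
    exact ⟨s.length, by simp, by simp⟩
  · rintro ⟨n, ha, hb⟩
    obtain ⟨hn, rfl⟩ := List.getElem?_eq_some_iff.1 ha
    obtain ⟨hn', rfl⟩ := List.getElem?_eq_some_iff.1 hb
    refine ⟨l.take n, l.drop (n + 2), ?_⟩
    conv_rhs => rw [← List.take_append_drop n l, List.drop_eq_getElem_cons hn,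
      List.drop_eq_getElem_cons hn']
    simp

theorem Step.lt {u w : ℤ × ℤ} (h : Step u w) : u.1 ≤ w.1 ∧ u.2 ≤ w.2 ∧ u.1 + u.2 < w.1 + w.2 := by
  rcases h with rfl | rfl <;> simp

theorem pairwise_of_isChain_step {p : List (ℤ × ℤ)} (h : p.IsChain Step) :
    p.Pairwise fun u w => u.1 ≤ w.1 ∧ u.2 ≤ w.2 ∧ u.1 + u.2 < w.1 + w.2 := by
  have : IsTrans (ℤ × ℤ) fun u w => u.1 ≤ w.1 ∧ u.2 ≤ w.2 ∧ u.1 + u.2 < w.1 + w.2 :=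
    ⟨fun a b c h h' => ⟨h.1.trans h'.1, h.2.1.trans h'.2.1, h.2.2.trans h'.2.2⟩⟩
  exact (h.imp fun _ _ => Step.lt).pairwise

theorem IsLatticePath.bounds {u w : ℤ × ℤ} {p : List (ℤ × ℤ)} (h : IsLatticePath u w p)
    {x : ℤ × ℤ} (hx : x ∈ p) : (u.1 ≤ x.1 ∧ u.2 ≤ x.2) ∧ x.1 ≤ w.1 ∧ x.2 ≤ w.2 := by
  obtain ⟨hc, hh, hl⟩ := h
  have hp := pairwise_of_isChain_step hc
  constructor
  · obtain ⟨q, rfl⟩ := List.head?_eq_some_iff.1 hh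
    rcases List.mem_cons.1 hx with rfl | hx
    · exact ⟨le_rfl, le_rfl⟩
    · have := List.rel_of_pairwise_cons hp hx
      exact ⟨this.1, this.2.1⟩
  · obtain ⟨q, rfl⟩ := List.getLast?_eq_some_iff.1 hl
    rcases List.mem_append.1 hx with hx | hx
    · have := (List.pairwise_append.1 hp).2.2 x hx w (by simp)
      exact ⟨this.1, this.2.1⟩
    · rw [List.mem_singleton.1 hx]
      exact ⟨le_rfl, le_rfl⟩

namespace PathFamily

variable {N : ℕ} {Q : Finset Point} (F : PathFamily N Q)

/-- The `i`-th path, prolonged by its two vertical arcs. -/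
def trail (i : Fin F.r) : List (ℤ × ℤ) :=
  (F.start i, (0 : ℤ)) :: (F.path i ++ [(F.finish i, (N : ℤ) + 1)])

theorem mem_trail {i : Fin F.r} {u : ℤ × ℤ} : u ∈ F.trail i ↔
    u = (F.start i, 0) ∨ u ∈ F.path i ∨ u = (F.finish i, (N : ℤ) + 1) := by
  simp [trail]

theorem path_bounds {i : Fin F.r} {u : ℤ × ℤ} (h : u ∈ F.path i) : 1 ≤ u.2 ∧ u.2 ≤ N :=
  ⟨((F.isPath i).bounds h).1.2, ((F.isPath i).bounds h).2.2⟩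

theorem eq_of_mem_trail {i j : Fin F.r} {u : ℤ × ℤ} (hi : u ∈ F.trail i) (hj : u ∈ F.trail j) :
    i = j := by
  rw [mem_trail] at hi hj
  rcases hi with rfl | hi | rfl <;> rcases hj with hj | hj | hj
  · exact F.start_anti.injective (congrArg Prod.fst hj)
  · have := F.path_bounds hj
    simp at this
  · have := congrArg Prod.snd hj
    simp at this
    omega
  · have := F.path_bounds hi
    simp [hj] at this
  · by_contra hne
    exact F.disjoint i j hne hi hj
  · have := F.path_bounds hi
    simp [hj] at this
  · have := congrArg Prod.snd hj
    simp at this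
    omega
  · have := F.path_bounds hj
    simp at this
  · exact F.finish_anti.injective (congrArg Prod.fst hj)

theorem isChain_trail (i : Fin F.r) : (F.trail i).IsChain Step := by
  obtain ⟨hc, hh, hl⟩ := F.isPath i
  rw [trail, List.isChain_cons, List.isChain_append]
  refine ⟨?_, hc, by simp, ?_⟩
  · obtain ⟨q, hq⟩ := List.head?_eq_some_iff.1 hh
    rw [hq]
    simp [Step]
  · rw [hl]
    simp [Step]

theorem nodup_trail (i : Fin F.r) : (F.trail i).Nodup := by
  refine (pairwise_of_isChain_step (F.isChain_trail i)).imp ?_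
  rintro a b h rfl
  exact lt_irrefl _ h.2.2

theorem mem_trail_of_infix {i : Fin F.r} {u w : ℤ × ℤ} (h : [u, w] <:+: F.trail i) :
    u ∈ F.trail i ∧ w ∈ F.trail i :=
  ⟨h.subset (by simp), h.subset (by simp)⟩

theorem exists_next {i : Fin F.r} {u : ℤ × ℤ} (h : u ∈ F.trail i) (hu : u.2 ≤ N) :
    ∃ w, [u, w] <:+: F.trail i := by
  obtain ⟨s, t, hst⟩ := List.append_of_mem h
  cases t with
  | nil =>
    exfalso
    rw [trail, ← List.cons_append] at hst
    have := (List.append_inj' hst rfl).2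
    rw [List.cons.injEq] at this
    rw [← this.1] at hu
    simp at hu
  | cons w t => exact ⟨w, s, t, by rw [hst]; simp⟩

theorem exists_prev {i : Fin F.r} {u : ℤ × ℤ} (h : u ∈ F.trail i) (hu : 1 ≤ u.2) :
    ∃ w, [w, u] <:+: F.trail i := by
  obtain ⟨s, t, hst⟩ := List.append_of_mem h
  rcases s.eq_nil_or_concat with rfl | ⟨s, w, rfl⟩
  · exfalso
    simp [trail] at hst
    rw [← hst.1] at hu
    simp at hu
  · exact ⟨w, s, t, by rw [hst]; simp⟩

/-- Distinct trails share no point and a single trail repeats none, so an arc is determined by its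
head and also by its tail. Only the two ends of a trail lie outside the heights `1, …, N`. -/
theorem isFlow_arcs : IsFlow N F.arcs := by
  have hh : ∀ i u, u ∈ F.trail i → (u.2 < 1 → u = (F.start i, 0)) ∧
      (N < u.2 → u = (F.finish i, (N : ℤ) + 1)) := by
    intro i u hu
    rw [mem_trail] at hu
    rcases hu with rfl | hu | rfl
    · simp
    · have := F.path_bounds hu
      constructor <;> intro <;> omega
    · simp
  refine ⟨?_, ?_, ?_, ?_, ?_, ?_⟩
  · refine Set.Finite.subset (Set.finite_iUnion fun i : Fin F.r =>
      (F.trail i).finite_toSet.prod (F.trail i).finite_toSet) ?_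
    rintro e ⟨i, hi⟩
    exact Set.mem_iUnion.2 ⟨i, F.mem_trail_of_infix hi⟩
  · rintro ⟨⟨x, k⟩, w⟩ ⟨i, hi⟩
    have hstep : Step (x, k) w := by
      have := (F.isChain_trail i).infix hi
      simpa using this
    obtain ⟨h1, h2⟩ := F.mem_trail_of_infix hi
    have h3 := hh i _ h1
    have h4 := hh i _ h2
    rcases hstep with rfl | rfl
    · right
      refine ⟨x, k, ?_, ?_, rfl⟩ <;> by_contra hk <;> simp at h3 h4 <;> grind
    · left
      refine ⟨x, k, ?_, ?_, rfl⟩ <;> by_contra hk <;> simp at h3 h4 <;> grind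
  · rintro ⟨e, u⟩ ⟨i, hi⟩ ⟨f, u'⟩ ⟨j, hj⟩ rfl
    obtain rfl := F.eq_of_mem_trail (F.mem_trail_of_infix hi).2 (F.mem_trail_of_infix hj).2
    obtain ⟨n, h1, h2⟩ := pair_infix_iff.1 hi
    obtain ⟨m, h3, h4⟩ := pair_infix_iff.1 hj
    have hnm : n + 1 = m + 1 := (List.getElem?_inj (List.getElem?_eq_some_iff.1 h2).1
      (F.nodup_trail i)).1 (h2.trans h4.symm)
    obtain rfl : n = m := by omega
    have : some e = some f := h1.symm.trans h3
    rw [Option.some_inj.1 this]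
  · rintro ⟨u, e⟩ ⟨i, hi⟩ ⟨u', f⟩ ⟨j, hj⟩ rfl
    obtain rfl := F.eq_of_mem_trail (F.mem_trail_of_infix hi).1 (F.mem_trail_of_infix hj).1
    obtain ⟨n, h1, h2⟩ := pair_infix_iff.1 hi
    obtain ⟨m, h3, h4⟩ := pair_infix_iff.1 hj
    obtain rfl : n = m := (List.getElem?_inj (List.getElem?_eq_some_iff.1 h1).1
      (F.nodup_trail i)).1 (h1.trans h3.symm)
    have : some e = some f := h2.symm.trans h4
    rw [Option.some_inj.1 this]
  · rintro ⟨e, u⟩ ⟨i, hi⟩ hu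
    obtain ⟨w, hw⟩ := F.exists_next (F.mem_trail_of_infix hi).2 hu
    exact ⟨(u, w), ⟨i, hw⟩, rfl⟩
  · rintro ⟨u, e⟩ ⟨i, hi⟩ hu
    obtain ⟨w, hw⟩ := F.exists_prev (F.mem_trail_of_infix hi).1 hu
    exact ⟨(w, u), ⟨i, hw⟩, rfl⟩

theorem isFlowOn_arcs (hN : 1 ≤ N) : IsFlowOn N Q F.arcs := by
  refine ⟨F.isFlow_arcs, ?_⟩
  rintro (x | x)
  · rw [F.mem_start]
    constructor
    · rintro ⟨i, hi⟩
      rcases F.mem_trail.1 (F.mem_trail_of_infix hi).1 with h | h | h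
      · exact ⟨i, (congrArg Prod.fst h).symm⟩
      · have := F.path_bounds h
        simp [stub] at this
      · have := congrArg Prod.snd h
        simp [stub] at this
        omega
    · rintro ⟨i, rfl⟩
      obtain ⟨q, hq⟩ := List.head?_eq_some_iff.1 (F.isPath i).2.1
      exact ⟨i, [], q ++ [(F.finish i, (N : ℤ) + 1)], by simp [stub, hq]⟩
  · rw [F.mem_finish]
    constructor
    · rintro ⟨i, hi⟩
      rcases F.mem_trail.1 (F.mem_trail_of_infix hi).2 with h | h | h
      · have := congrArg Prod.snd h
        simp [stub] at this
        omega
      · have := F.path_bounds h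
        simp [stub] at this
      · exact ⟨i, (congrArg Prod.fst h).symm⟩
    · rintro ⟨i, rfl⟩
      obtain ⟨q, hq⟩ := List.getLast?_eq_some_iff.1 (F.isPath i).2.2
      exact ⟨i, (F.start i, 0) :: q, [], by simp [stub, hq]⟩

/-- The additional end of a starting arc is only left and that of an ending arc only entered, so
requiring both directions singles out the points of the original paths. -/
theorem mem_vertices_iff (u : ℤ × ℤ) :
    u ∈ F.vertices ↔ (∃ e ∈ F.arcs, e.2 = u) ∧ ∃ e ∈ F.arcs, e.1 = u := by
  constructor
  · rintro ⟨i, hi⟩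
    have hu := F.path_bounds hi
    have hi : u ∈ F.trail i := F.mem_trail.2 (.inr (.inl hi))
    obtain ⟨w, hw⟩ := F.exists_next hi hu.2
    obtain ⟨w', hw'⟩ := F.exists_prev hi hu.1
    exact ⟨⟨(w', u), ⟨i, hw'⟩, rfl⟩, (u, w), ⟨i, hw⟩, rfl⟩
  · rintro ⟨⟨⟨w, u⟩, ⟨i, hi⟩, rfl⟩, ⟨⟨u', w'⟩, ⟨j, hj⟩, h⟩⟩
    obtain rfl : u' = u := h
    have hF := F.isFlow_arcs
    have h1 := hF.one_le_head (e := (w, u')) ⟨i, hi⟩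
    have h2 := hF.tail_le (e := (u', w')) ⟨j, hj⟩
    rcases F.mem_trail.1 (F.mem_trail_of_infix hi).2 with h | h | h
    · obtain rfl : u' = _ := h
      simp at h1
    · exact ⟨i, h⟩
    · simp at h
      simp [h] at h2

end PathFamily

/-! ### Bicoloured paths in terms of the union and the intersection of the arc sets -/

section

variable {N : ℕ} {K : Configuration} {v : Orientation K}

theorem isFlow_overlay (P : Overlay N v) (c : Colour) : IsFlow N (P c).arcs :=
  (P c).isFlow_arcs

theorem meet_iff (P : Overlay N v) (u : ℤ × ℤ) : Meet P u ↔
    MeetAt N (allArcs fun c => (P c).arcs) (commonArcs fun c => (P c).arcs) u := by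
  rw [meetAt_iff (isFlow_overlay P)]
  exact forall_congr' fun c => (P c).mem_vertices_iff u

theorem exists_hasOnlyColour_iff (P : Overlay N v) (e : Arc) : (∃ c, HasOnlyColour P c e) ↔
    e ∈ (allArcs fun c => (P c).arcs) ∧ e ∉ (commonArcs fun c => (P c).arcs) := by
  constructor
  · rintro ⟨c, hc⟩
    refine ⟨⟨c, (hc c).2 rfl⟩, fun h => ?_⟩
    exact c.other_ne ((hc _).1 (h _))
  · rintro ⟨⟨c, hc⟩, h⟩
    rw [mem_commonArcs c] at h
    refine ⟨c, fun d => ?_⟩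
    rcases c.eq_or_eq_other d with rfl | rfl
    · simpa using hc
    · simpa [c.other_ne] using fun h' => h ⟨hc, h'⟩

/-- The conditions on colours are automatic. If two arcs of different colours pass through `u`, one
entering and one leaving, then conservation makes `u` a meeting point; two different arcs that both
enter or both leave `u` cannot have the same colour. -/
theorem consecutive_iff (P : Overlay N v) (e f : Arc) : Consecutive P e f ↔
    Linked N (allArcs fun c => (P c).arcs) (commonArcs fun c => (P c).arcs) e f := by
  have hP := isFlow_overlay P
  simp only [Linked, ← meet_iff, ← exists_hasOnlyColour_iff]
  constructor
  · rintro ⟨c, d, u, hc, hd, h⟩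
    refine ⟨⟨c, hc⟩, ⟨d, hd⟩, u, ?_⟩
    rcases h with ⟨h1, -, h2⟩ | ⟨h1, hne, h2⟩
    · exact .inl ⟨h1, h2⟩
    · refine .inr ⟨h1, ?_, h2⟩
      rintro rfl
      exact hne ((hd c).1 ((hc c).2 rfl))
  · rintro ⟨⟨c, hc⟩, ⟨d, hd⟩, u, h⟩
    have he := (hc c).2 rfl
    have hf := (hd d).2 rfl
    refine ⟨c, d, u, hc, hd, ?_⟩
    rcases h with ⟨h1, h2⟩ | ⟨h1, hne, h2⟩
    · refine .inl ⟨h1, ?_, h2⟩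
      by_contra hcd
      refine h1 fun c' => ?_
      have : c' = c ∨ c' = d := by
        cases c <;> cases d <;> cases c' <;> simp at hcd ⊢
      rw [PathFamily.mem_vertices_iff]
      rcases h2 with ⟨rfl, hfe⟩ | ⟨rfl, hfe⟩
      · rcases this with rfl | rfl
        · exact ⟨⟨e, he, rfl⟩, (hP _).out_of_in e he (hfe ▸ (hP _).tail_le hf)⟩
        · exact ⟨hfe ▸ (hP _).in_of_out f hf (hfe ▸ (hP _).one_le_head he), f, hf, hfe⟩
      · rcases this with rfl | rfl
        · exact ⟨(hP _).in_of_out e he (hfe ▸ (hP _).one_le_head hf), e, he, rfl⟩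
        · exact ⟨⟨f, hf, hfe⟩, hfe ▸ (hP _).out_of_in f hf (hfe ▸ (hP _).tail_le he)⟩
    · refine .inr ⟨h1, ?_, h2⟩
      rintro rfl
      rcases h2 with ⟨h2, h3⟩ | ⟨h2, h3⟩
      · exact hne ((hP c).head_inj e he f hf (h2.trans h3.symm))
      · exact hne ((hP c).tail_inj e he f hf (h2.trans h3.symm))

/-- The arcs representing the points in `S`. -/
def stubs (N : ℕ) {K : Configuration} (S : Set {q // q ∈ K.coloured}) : Set Arc :=
  {e | ∃ q ∈ S, stub N q.1 = e}

theorem isRecolouring_iff {w : Orientation K} (S : Set {q // q ∈ K.coloured})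
    (P : Overlay N v) (P' : Overlay N w) : IsRecolouring S P P' ↔
      (fun c => (P' c).arcs) = recolour N (fun c => (P c).arcs) (stubs N S) := by
  have : (⋃ q ∈ S, bicolouredPath P q.1) =
      linkedArcs N (fun c => (P c).arcs) (stubs N S) := by
    ext e
    have h : Consecutive P = Linked N (allArcs fun c => (P c).arcs)
        (commonArcs fun c => (P c).arcs) := by
      ext e f
      exact consecutive_iff P e f
    simp only [Set.mem_iUnion, bicolouredPath, linkedArcs, stubs, Set.mem_ofPred_eq, h]
    constructor
    · rintro ⟨q, hq, h⟩
      exact ⟨_, ⟨q, hq, rfl⟩, h⟩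
    · rintro ⟨_, ⟨q, hq, rfl⟩, h⟩
      exact ⟨q, hq, h⟩
  rw [IsRecolouring, this, funext_iff]
  rfl

end

/-! ### Patterns: the positions of the vertical arcs of nonintersecting paths -/

/-- `a k i` is the abscissa of the vertical arc of the `i`-th path that starts at height `k`. -/
structure IsPattern (N : ℕ) {r : ℕ} (a : ℕ → Fin r → ℤ) : Prop where
  anti_zero : StrictAnti (a 0)
  le : ∀ k < N, ∀ i, a k i ≤ a (k + 1) i
  lt : ∀ k < N, ∀ i j, i < j → a (k + 1) j < a k i

/-- The arcs of the paths of a pattern. -/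
def patternArcs (N : ℕ) {r : ℕ} (a : ℕ → Fin r → ℤ) : Set Arc :=
  {e | (∃ (k : ℕ) (i : Fin r), k ≤ N ∧ e = vert (a k i) k) ∨
    ∃ (k : ℕ) (i : Fin r) (x : ℤ), k < N ∧ a k i ≤ x ∧ x < a (k + 1) i ∧ e = hor x ((k : ℤ) + 1)}

theorem vert_inj {x k y l : ℤ} : vert x k = vert y l ↔ x = y ∧ k = l := by
  simp only [vert, Prod.mk.injEq]
  omega

theorem hor_inj {x k y l : ℤ} : hor x k = hor y l ↔ x = y ∧ k = l := by
  simp only [hor, Prod.mk.injEq]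
  omega

theorem vert_ne_hor {x k y l : ℤ} : vert x k ≠ hor y l := by
  simp only [vert, hor, ne_eq, Prod.mk.injEq]
  omega

theorem vert_mem_patternArcs {N r : ℕ} {a : ℕ → Fin r → ℤ} {x : ℤ} {k : ℕ} :
    vert x k ∈ patternArcs N a ↔ k ≤ N ∧ ∃ i, a k i = x := by
  constructor
  · rintro (⟨l, i, hl, h⟩ | ⟨l, i, y, hl, h1, h2, h⟩)
    · rw [vert_inj] at h
      obtain ⟨rfl, h⟩ := h
      obtain rfl : k = l := by exact_mod_cast h
      exact ⟨hl, i, rfl⟩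
    · exact (vert_ne_hor h).elim
  · rintro ⟨hk, i, rfl⟩
    exact .inl ⟨k, i, hk, rfl⟩

theorem hor_mem_patternArcs {N r : ℕ} {a : ℕ → Fin r → ℤ} {x : ℤ} {k : ℕ} :
    hor x (k + 1) ∈ patternArcs N a ↔ k < N ∧ ∃ i, a k i ≤ x ∧ x < a (k + 1) i := by
  constructor
  · rintro (⟨l, i, hl, h⟩ | ⟨l, i, y, hl, h1, h2, h⟩)
    · exact (vert_ne_hor h.symm).elim
    · rw [hor_inj] at h
      obtain ⟨rfl, h⟩ := h
      obtain rfl : k = l := by omega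
      exact ⟨hl, i, h1, h2⟩
  · rintro ⟨hk, i, h1, h2⟩
    exact .inr ⟨k, i, x, hk, h1, h2, rfl⟩

/-! ### From a flow to its pattern -/

namespace IsFlow

variable {N : ℕ} {A : Set Arc} (hA : IsFlow N A)

include hA

theorem out_cases {u : ℤ × ℤ} (hu : u.2 ≤ N) (h : ∃ e ∈ A, e.2 = u) :
    vert u.1 u.2 ∈ A ∨ hor u.1 u.2 ∈ A := by
  obtain ⟨e, he, rfl⟩ := h
  obtain ⟨f, hf, hfe⟩ := hA.out_of_in e he hu
  rw [← hfe]
  rcases hA.mem_cases f hf with ⟨x, k, -, -, rfl⟩ | ⟨x, k, -, -, rfl⟩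
  · exact .inl hf
  · exact .inr hf

theorem in_cases {u : ℤ × ℤ} (hu : 1 ≤ u.2) (h : ∃ e ∈ A, e.1 = u) :
    vert u.1 (u.2 - 1) ∈ A ∨ hor (u.1 - 1) u.2 ∈ A := by
  obtain ⟨e, he, rfl⟩ := h
  obtain ⟨f, hf, hfe⟩ := hA.in_of_out e he hu
  rw [← hfe]
  rcases hA.mem_cases f hf with ⟨x, k, -, -, rfl⟩ | ⟨x, k, -, -, rfl⟩
  · left
    simpa [vert] using hf
  · right
    simpa [hor] using hf

theorem exists_bounds : ∃ m M : ℤ, ∀ e ∈ A, m ≤ e.1.1 ∧ e.1.1 ≤ M := by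
  have hfin : ((fun e : Arc => e.1.1) '' A).Finite := hA.finite.image _
  obtain ⟨m, hm⟩ := hfin.bddBelow
  obtain ⟨M, hM⟩ := hfin.bddAbove
  exact ⟨m, M, fun e he => ⟨hm ⟨e, he, rfl⟩, hM ⟨e, he, rfl⟩⟩⟩

/-- A path that enters the height `k` leaves it upwards after a horizontal run. -/
theorem exists_run_right {x k : ℤ} (hk : k ≤ N) (h : ∃ e ∈ A, e.2 = (x, k)) :
    ∃ y, x ≤ y ∧ vert y k ∈ A ∧ ∀ z, x ≤ z → z < y → hor z k ∈ A := by
  obtain ⟨m, M, hM⟩ := hA.exists_bounds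
  -- No arc has its tail to the right of `M`, so the horizontal run has to end.
  induction hn : (M + 1 - x).toNat generalizing x with
  | zero =>
    rcases hA.out_cases (u := (x, k)) hk h with h | h
    · exact ⟨x, le_rfl, h, fun z h1 h2 => absurd h1 (by omega)⟩
    · have := (hM _ h).2
      simp only [hor] at this
      omega
  | succ n ih =>
    rcases hA.out_cases (u := (x, k)) hk h with h | h
    · exact ⟨x, le_rfl, h, fun z h1 h2 => absurd h1 (by omega)⟩
    · obtain ⟨y, h1, h2, h3⟩ := ih (x := x + 1) ⟨_, h, rfl⟩ (by omega)
      refine ⟨y, by omega, h2, fun z hz hzy => ?_⟩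
      rcases hz.eq_or_lt with rfl | hz
      · exact h
      · exact h3 z (by omega) hzy

/-- A path that uses a point of height `k` has entered this height from below. -/
theorem exists_run_left {x k : ℤ} (hk : 1 ≤ k) (h : ∃ e ∈ A, e.1 = (x, k)) :
    ∃ y, y ≤ x ∧ vert y (k - 1) ∈ A ∧ ∀ z, y ≤ z → z < x → hor z k ∈ A := by
  obtain ⟨m, M, hm⟩ := hA.exists_bounds
  induction hn : (x + 1 - m).toNat generalizing x with
  | zero =>
    obtain ⟨e, he, hx⟩ := h
    have := (hm _ he).1
    rw [hx] at this
    simp only at this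
    omega
  | succ n ih =>
    rcases hA.in_cases (u := (x, k)) hk h with h | h
    · exact ⟨x, le_rfl, h, fun z h1 h2 => absurd h1 (by omega)⟩
    · obtain ⟨y, h1, h2, h3⟩ := ih (x := x - 1) ⟨_, h, rfl⟩ (by omega)
      refine ⟨y, by omega, h2, fun z hz hzx => ?_⟩
      by_cases hzx' : z = x - 1
      · exact hzx' ▸ h
      · exact h3 z hz (by omega)

theorem not_vert_and_hor {x k : ℤ} (hv : vert x k ∈ A) (hh : hor x k ∈ A) : False :=
  vert_ne_hor (hA.tail_inj _ hv _ hh rfl)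

theorem not_vert_and_hor' {x k : ℤ} (hv : vert x k ∈ A) (hh : hor (x - 1) (k + 1) ∈ A) : False :=
  vert_ne_hor (hA.head_inj _ hv _ hh (by simp [vert, hor]))

/-- Each path is followed upwards: after a vertical arc it runs to the right until the next vertical
arc. Tracing runs back to the left shows that no other arcs exist, so a flow has no cycles or stray
components. -/
theorem exists_pattern {r : ℕ} {s : Fin r → ℤ} (hs : StrictAnti s)
    (hs0 : ∀ x, vert x 0 ∈ A ↔ ∃ i, s i = x) :
    ∃ a : ℕ → Fin r → ℤ, a 0 = s ∧ IsPattern N a ∧ A = patternArcs N a := by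
  have hnext : ∀ (k : ℕ) (x : ℤ), ∃ y, k < N → vert x k ∈ A →
      x ≤ y ∧ vert y (k + 1) ∈ A ∧ ∀ z, x ≤ z → z < y → hor z (k + 1) ∈ A := by
    intro k x
    by_cases h : k < N ∧ vert x k ∈ A
    · obtain ⟨y, hy⟩ := hA.exists_run_right (x := x) (k := k + 1) (by omega) ⟨_, h.2, rfl⟩
      exact ⟨y, fun _ _ => hy⟩
    · exact ⟨0, fun h1 h2 => absurd ⟨h1, h2⟩ h⟩
  choose nxt hnxt using hnext
  let a : ℕ → Fin r → ℤ := fun k => Nat.rec s (fun k ak i => nxt k (ak i)) k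
  have ha : ∀ k i, a (k + 1) i = nxt k (a k i) := fun _ _ => rfl
  have hmem : ∀ k ≤ N, ∀ i, vert (a k i) k ∈ A := by
    intro k
    induction k with
    | zero => exact fun _ i => (hs0 _).2 ⟨i, rfl⟩
    | succ k ih =>
      intro hk i
      rw [ha]
      exact_mod_cast (hnxt k (a k i) hk (ih (by omega) i)).2.1
  have hrun : ∀ k < N, ∀ i, a k i ≤ a (k + 1) i ∧
      ∀ z, a k i ≤ z → z < a (k + 1) i → hor z (k + 1) ∈ A := by
    intro k hk i
    have := hnxt k (a k i) hk (hmem k hk.le i)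
    exact ⟨this.1, this.2.2⟩
  have hanti : ∀ k ≤ N, ∀ i j, i < j → a k j < a k i ∧ (k < N → a (k + 1) j < a k i) := by
    have key : ∀ k < N, ∀ i j, a k j < a k i → a (k + 1) j < a k i := by
      intro k hk i j hij
      by_contra hle
      -- Otherwise the run of path `j` on height `k + 1` would enter the head of the vertical arc of
      -- path `i` horizontally.
      refine hA.not_vert_and_hor' (hmem k hk.le i) ((hrun k hk j).2 _ ?_ ?_) <;> omega
    intro k
    induction k with
    | zero => exact fun _ i j hij => ⟨hs hij, fun h => key 0 h i j (hs hij)⟩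
    | succ k ih =>
      intro hk i j hij
      have h1 : a (k + 1) j < a (k + 1) i :=
        ((ih (by omega) i j hij).2 hk).trans_le (hrun k hk i).1
      exact ⟨h1, fun h => key _ h i j h1⟩
  have hvert : ∀ k ≤ N, ∀ x, vert x (k : ℕ) ∈ A → ∃ i, a k i = x := by
    intro k
    induction k with
    | zero => exact fun _ x h => (hs0 x).1 (by exact_mod_cast h)
    | succ k ih =>
      intro hk x hx
      obtain ⟨y, hyx, hy, hrun'⟩ := hA.exists_run_left (x := x) (k := (k : ℤ) + 1) (by omega)
        ⟨_, hx, by simp [vert]⟩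
      obtain ⟨i, rfl⟩ := ih (by omega) y (by simpa using hy)
      refine ⟨i, ?_⟩
      -- Both runs start at `a k i` on the same height. If they differed in length, the end of the
      -- shorter one would be left both vertically and horizontally.
      rcases lt_trichotomy (a (k + 1) i) x with h | h | h
      · exact (hA.not_vert_and_hor (hmem (k + 1) hk i)
          (by exact_mod_cast hrun' _ (hrun k hk i).1 h)).elim
      · exact h
      · exact (hA.not_vert_and_hor hx (by exact_mod_cast (hrun k hk i).2 x hyx h)).elim
  refine ⟨a, rfl, ⟨hs, fun k hk i => (hrun k hk i).1,
    fun k hk i j hij => (hanti k hk.le i j hij).2 hk⟩, ?_⟩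
  ext e
  constructor
  · intro he
    rcases hA.mem_cases e he with ⟨x, k, h0, h1, rfl⟩ | ⟨x, k, h0, h1, rfl⟩
    · lift k to ℕ using h0
      obtain ⟨i, rfl⟩ := hvert k (by omega) x he
      exact .inl ⟨k, i, by omega, rfl⟩
    · obtain ⟨k, rfl⟩ : ∃ l : ℕ, k = (l : ℤ) + 1 := ⟨(k - 1).toNat, by omega⟩
      obtain ⟨y, hyx, hy, hrun'⟩ := hA.exists_run_left (x := x) (k := (k : ℤ) + 1) (by omega)
        ⟨_, he, rfl⟩
      obtain ⟨i, rfl⟩ := hvert k (by omega) y (by simpa using hy)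
      refine .inr ⟨k, i, x, by omega, hyx, ?_, rfl⟩
      by_contra hle
      have hk : k < N := by omega
      have hv := hmem (k + 1) hk i
      rcases (not_lt.1 hle).eq_or_lt with h | h
      · rw [← h] at he
        exact hA.not_vert_and_hor hv (by exact_mod_cast he)
      · exact hA.not_vert_and_hor hv (by exact_mod_cast hrun' _ (hrun k hk i).1 h)
  · rintro (⟨k, i, hk, rfl⟩ | ⟨k, i, x, hk, h1, h2, rfl⟩)
    · exact hmem k hk i
    · exact (hrun k hk i).2 x h1 h2

end IsFlow

/-! ### From a pattern to a flow and to a family of paths -/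

namespace IsPattern

variable {N r : ℕ} {a : ℕ → Fin r → ℤ} (ha : IsPattern N a)

include ha

theorem strictAnti {k : ℕ} (hk : k ≤ N) : StrictAnti (a k) := by
  cases k with
  | zero => exact ha.anti_zero
  | succ k => exact fun i j hij => (ha.lt k hk i j hij).trans_le (ha.le k hk i)

/-- On each height, the intervals occupied by different paths are disjoint. -/
theorem eq_of_mem_interval {k : ℕ} (hk : k < N) {i j : Fin r} {x : ℤ}
    (hi : a k i ≤ x) (hi' : x ≤ a (k + 1) i) (hj : a k j ≤ x) (hj' : x ≤ a (k + 1) j) : i = j := by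
  rcases lt_trichotomy i j with h | h | h
  · have := ha.lt k hk i j h
    omega
  · exact h
  · have := ha.lt k hk j i h
    omega

theorem isFlow : IsFlow N (patternArcs N a) := by
  refine ⟨?_, ?_, ?_, ?_, ?_, ?_⟩
  · have h1 : {e | ∃ (k : ℕ) (i : Fin r), k ≤ N ∧ e = vert (a k i) k}.Finite := by
      refine Set.Finite.subset ((Set.finite_Iic N).prod (Set.finite_univ (α := Fin r)) |>.image
        fun p => vert (a p.1 p.2) p.1) ?_
      rintro e ⟨k, i, hk, rfl⟩
      exact ⟨(k, i), ⟨hk, trivial⟩, rfl⟩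
    have h2 : {e | ∃ (k : ℕ) (i : Fin r) (x : ℤ), k < N ∧ a k i ≤ x ∧ x < a (k + 1) i ∧
        e = hor x ((k : ℤ) + 1)}.Finite := by
      refine Set.Finite.subset ((Set.finite_Iio N).biUnion fun k _ =>
        Set.finite_iUnion fun i : Fin r =>
          (Set.finite_Ico (a k i) (a (k + 1) i)).image fun x => hor x ((k : ℤ) + 1)) ?_
      rintro e ⟨k, i, x, hk, h1, h2, rfl⟩
      simp only [Set.mem_iUnion]
      exact ⟨k, hk, i, x, ⟨h1, h2⟩, rfl⟩
    exact h1.union h2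
  · rintro e (⟨k, i, hk, rfl⟩ | ⟨k, i, x, hk, h1, h2, rfl⟩)
    · exact .inl ⟨_, k, by omega, by omega, rfl⟩
    · exact .inr ⟨x, k + 1, by omega, by omega, rfl⟩
  · rintro e (⟨k, i, hk, rfl⟩ | ⟨k, i, x, hk, h1, h2, rfl⟩) f
      (⟨l, j, hl, rfl⟩ | ⟨l, j, y, hl, h3, h4, rfl⟩) h <;>
      simp only [vert, hor, Prod.mk.injEq] at h <;> obtain ⟨hx, hkl⟩ := h
    · obtain rfl : k = l := by omega
      rw [hx]
    · obtain rfl : k = l := by omega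
      have := ha.le k hl i
      obtain rfl := ha.eq_of_mem_interval hl (x := a k i) (i := i) (j := j) le_rfl this
        (by omega) (by omega)
      omega
    · obtain rfl : k = l := by omega
      have := ha.le k hk j
      obtain rfl := ha.eq_of_mem_interval hk (x := a k j) (i := i) (j := j) (by omega) (by omega)
        le_rfl this
      omega
    · obtain rfl : k = l := by omega
      obtain rfl : x = y := by omega
      rfl
  · rintro e (⟨k, i, hk, rfl⟩ | ⟨k, i, x, hk, h1, h2, rfl⟩) f
      (⟨l, j, hl, rfl⟩ | ⟨l, j, y, hl, h3, h4, rfl⟩) h <;>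
      simp only [vert, hor, Prod.mk.injEq] at h <;> obtain ⟨hx, hkl⟩ := h
    · obtain rfl : k = l := by omega
      rw [hx]
    · obtain rfl : k = l + 1 := by omega
      have := ha.le l hl i
      obtain rfl := ha.eq_of_mem_interval hl (x := a (l + 1) i) (i := i) (j := j) this le_rfl
        (by omega) (by omega)
      omega
    · obtain rfl : l = k + 1 := by omega
      have := ha.le k hk j
      obtain rfl := ha.eq_of_mem_interval hk (x := a (k + 1) j) (i := i) (j := j) (by omega)
        (by omega) this le_rfl
      omega
    · obtain rfl : k = l := by omega
      obtain rfl : x = y := by omega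
      rfl
  · have key : ∀ (k : ℕ) (i : Fin r) (x : ℤ), k < N → a k i ≤ x → x ≤ a (k + 1) i →
        ∃ f ∈ patternArcs N a, f.1 = (x, (k : ℤ) + 1) := by
      intro k i x hk h1 h2
      rcases h2.eq_or_lt with rfl | h2
      · exact ⟨_, .inl ⟨k + 1, i, hk, rfl⟩, by simp [vert]⟩
      · exact ⟨_, .inr ⟨k, i, x, hk, h1, h2, rfl⟩, by simp [hor]⟩
    rintro e (⟨k, i, hk, rfl⟩ | ⟨k, i, x, hk, h1, h2, rfl⟩) hu
    · simp only [vert] at hu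
      have hk : k < N := by omega
      exact key k i _ hk le_rfl (ha.le k hk i)
    · exact key k i _ hk (by omega) (by omega)
  · have key : ∀ (k : ℕ) (i : Fin r) (x : ℤ), k < N → a k i ≤ x → x ≤ a (k + 1) i →
        ∃ f ∈ patternArcs N a, f.2 = (x, (k : ℤ) + 1) := by
      intro k i x hk h1 h2
      rcases h1.eq_or_lt with rfl | h1
      · exact ⟨_, .inl ⟨k, i, hk.le, rfl⟩, by simp [vert]⟩
      · exact ⟨_, .inr ⟨k, i, x - 1, hk, by omega, by omega, rfl⟩, by simp [hor]⟩
    rintro e (⟨k, i, hk, rfl⟩ | ⟨k, i, x, hk, h1, h2, rfl⟩) hu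
    · simp only [vert] at hu
      obtain ⟨k, rfl⟩ : ∃ l, k = l + 1 := ⟨k - 1, by omega⟩
      simpa [vert] using key k i _ hk (ha.le k hk i) le_rfl
    · exact key k i _ hk (by omega) (by omega)

theorem isFlowOn {Q : Finset Point} (hQ : ∀ x, Sum.inl x ∈ Q ↔ ∃ i, a 0 i = x)
    (hQ' : ∀ x, Sum.inr x ∈ Q ↔ ∃ i, a N i = x) : IsFlowOn N Q (patternArcs N a) := by
  refine ⟨ha.isFlow, ?_⟩
  rintro (x | x)
  · rw [hQ, show stub N (Sum.inl x) = vert x (0 : ℕ) by simp [stub, vert], vert_mem_patternArcs]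
    simp
  · rw [hQ', show stub N (Sum.inr x) = vert x (N : ℕ) by simp [stub, vert], vert_mem_patternArcs]
    simp

/-- Each point of the `i`-th path can be reached from its starting point. -/
theorem reachable {k : ℕ} (hk : k < N) {i : Fin r} {x : ℤ} (h1 : a k i ≤ x)
    (h2 : x ≤ a (k + 1) i) : Relation.ReflTransGen (fun u w => (u, w) ∈ patternArcs N a)
      (a 0 i, (1 : ℤ)) (x, (k : ℤ) + 1) := by
  have hrun : ∀ k < N, ∀ x, a k i ≤ x → x ≤ a (k + 1) i →
      Relation.ReflTransGen (fun u w => (u, w) ∈ patternArcs N a)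
        (a k i, (k : ℤ) + 1) (x, (k : ℤ) + 1) := by
    intro k hk x hx
    induction x, hx using Int.leInduction with
    | base => exact fun _ => .refl
    | succ x hx ih =>
      exact fun h => (ih (by omega)).tail (.inr ⟨k, i, x, hk, hx, by omega, rfl⟩)
  refine Relation.ReflTransGen.trans ?_ (hrun k hk x h1 h2)
  clear h1 h2
  induction k with
  | zero => simpa using Relation.ReflTransGen.refl
  | succ k ih =>
    refine ((ih (by omega)).trans
      (hrun k (by omega) _ (ha.le k (by omega) i) le_rfl)).tail (.inl ⟨k + 1, i, hk.le, ?_⟩)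
    simp [vert]

/-- The paths are chains of arcs supplied by reachability. They are disjoint because a flow can be
traced backwards in only one way. -/
theorem exists_pathFamily (hN : 1 ≤ N) {Q : Finset Point}
    (hQ : ∀ x, Sum.inl x ∈ Q ↔ ∃ i, a 0 i = x)
    (hQ' : ∀ x, Sum.inr x ∈ Q ↔ ∃ i, a N i = x) :
    ∃ F : PathFamily N Q, F.arcs = patternArcs N a := by
  have hA := ha.isFlow
  have hstart : ∀ i, ((a 0 i, (0 : ℤ)), (a 0 i, (1 : ℤ))) ∈ patternArcs N a := fun i =>
    .inl ⟨0, i, by omega, by simp [vert]⟩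
  have hpath : ∀ i, ∃ l, List.IsChain (fun u w => (u, w) ∈ patternArcs N a)
      ((a 0 i, (1 : ℤ)) :: l) ∧ ((a 0 i, (1 : ℤ)) :: l).getLast? = some (a N i, (N : ℤ)) := by
    intro i
    obtain ⟨n, rfl⟩ : ∃ n, N = n + 1 := ⟨N - 1, by omega⟩
    obtain ⟨l, hl, hl'⟩ := List.exists_isChain_cons_of_relationReflTransGen
      (ha.reachable (Nat.lt_succ_self n) (ha.le n (Nat.lt_succ_self n) i) le_rfl)
    refine ⟨l, hl, ?_⟩
    rw [List.getLast?_eq_getLast_of_ne_nil (by simp), hl']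
    simp
  choose l hl hl' using hpath
  have hstep : ∀ u w, (u, w) ∈ patternArcs N a → Step u w := by
    intro u w h
    rcases hA.mem_cases _ h with ⟨x, k, -, -, h⟩ | ⟨x, k, -, -, h⟩
    · obtain ⟨rfl, rfl⟩ := Prod.mk.inj h
      exact .inr rfl
    · obtain ⟨rfl, rfl⟩ := Prod.mk.inj h
      exact .inl rfl
  have hreach : ∀ i, ∀ u ∈ (a 0 i, (1 : ℤ)) :: l i,
      Relation.ReflTransGen (fun u w => (u, w) ∈ patternArcs N a) (a 0 i, (0 : ℤ)) u := by
    intro i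
    refine (hl i).induction _ _ (fun _ _ h h' => h'.tail h) fun _ => ?_
    exact Relation.ReflTransGen.single (hstart i)
  have huniq : ∀ i j u,
      Relation.ReflTransGen (fun u w => (u, w) ∈ patternArcs N a) (a 0 i, (0 : ℤ)) u →
      Relation.ReflTransGen (fun u w => (u, w) ∈ patternArcs N a) (a 0 j, (0 : ℤ)) u →
      i = j := by
    have key : ∀ i u, Relation.ReflTransGen (fun u w => (u, w) ∈ patternArcs N a) u
        (a 0 i, (0 : ℤ)) → u = (a 0 i, 0) := by
      intro i u h
      rcases Relation.ReflTransGen.cases_tail h with h | ⟨w, -, h⟩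
      · exact h.symm
      · have := hA.one_le_head h
        simp at this
    intro i j u hi hj
    rw [← Relation.reflTransGen_swap] at hi hj
    -- In the reversed relation each point has at most one successor, so of two starting ends
    -- reached from `u` one is reached from the other. By `key`, nothing enters height `0`, hence
    -- they coincide.
    have htot := Relation.ReflTransGen.total_of_right_unique (fun u w w' h h' => by
      have := hA.head_inj _ h _ h' rfl
      exact (Prod.mk.inj this).1) hi hj
    apply ha.anti_zero.injective
    rcases htot with h | h
    · exact ((Prod.mk.inj (key _ _ (Relation.reflTransGen_swap.1 h))).1).symm
    · exact (Prod.mk.inj (key _ _ (Relation.reflTransGen_swap.1 h))).1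
  let F : PathFamily N Q :=
    { r := r
      start := a 0
      finish := a N
      path := fun i => (a 0 i, 1) :: l i
      start_anti := ha.anti_zero
      finish_anti := ha.strictAnti le_rfl
      mem_start := hQ
      mem_finish := hQ'
      isPath := fun i => ⟨(hl i).imp hstep, rfl, hl' i⟩
      disjoint := fun i j hij u hi hj => hij (huniq i j u (hreach i u hi) (hreach j u hj)) }
  have hsub : F.arcs ⊆ patternArcs N a := by
    rintro e ⟨i, hi⟩
    have hc : List.IsChain (fun u w => (u, w) ∈ patternArcs N a) (F.trail i) := by
      rw [PathFamily.trail, List.isChain_cons, List.isChain_append]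
      refine ⟨?_, hl i, by simp, ?_⟩
      · simpa [F] using hstart i
      · simp only [F]
        rw [hl']
        simp only [Option.mem_def, Option.some.injEq, List.head?_cons, forall_eq']
        exact .inl ⟨N, i, le_rfl, by simp [vert]⟩
    simpa using hc.infix hi
  -- For the converse inclusion, the arcs of `F` are themselves a flow: wherever `F` enters a point
  -- it also leaves it, and the leaving arc of the pattern is unique.
  refine ⟨F, hsub.antisymm ?_⟩
  have hF := F.isFlowOn_arcs hN
  have hFs : ∀ i, ((a 0 i, (0 : ℤ)), (a 0 i, (1 : ℤ))) ∈ F.arcs := fun i =>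
    (hF.stub_mem (.inl (a 0 i))).2 ((hQ _).2 ⟨i, rfl⟩)
  have key : ∀ i u, Relation.ReflTransGen (fun u w => (u, w) ∈ patternArcs N a)
      (a 0 i, (1 : ℤ)) u → ∃ w, (w, u) ∈ F.arcs := by
    intro i u h
    induction h with
    | refl => exact ⟨_, hFs i⟩
    | @tail u w h huw ih =>
      obtain ⟨w', hw'⟩ := ih
      obtain ⟨f, hf, hfu⟩ := hF.out_of_in _ hw' (hA.tail_le huw)
      rw [hA.tail_inj f (hsub hf) _ huw hfu] at hf
      exact ⟨u, hf⟩
  have key' : ∀ i e, e ∈ patternArcs N a → Relation.ReflTransGen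
      (fun u w => (u, w) ∈ patternArcs N a) (a 0 i, (1 : ℤ)) e.1 → e ∈ F.arcs := by
    intro i e he h
    obtain ⟨w', hw'⟩ := key i _ h
    obtain ⟨f, hf, hfu⟩ := hF.out_of_in _ hw' (hA.tail_le he)
    rwa [hA.tail_inj f (hsub hf) _ he hfu] at hf
  rintro e he
  have he' := he
  rcases he' with ⟨k, i, hk, rfl⟩ | ⟨k, i, x, hk, h1, h2, rfl⟩
  · cases k with
    | zero => simpa [vert] using hFs i
    | succ k =>
      refine key' i _ he ?_
      simpa [vert] using ha.reachable hk (ha.le k hk i) le_rfl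
  · exact key' i _ he (ha.reachable hk h1 h2.le)

end IsPattern

/-! ### Tableaux and flows -/

theorem patternArcs_congr {N r : ℕ} {a b : ℕ → Fin r → ℤ} (h : ∀ k ≤ N, a k = b k) :
    patternArcs N a = patternArcs N b := by
  have key : ∀ {a b : ℕ → Fin r → ℤ}, (∀ k ≤ N, a k = b k) →
      patternArcs N a ⊆ patternArcs N b := by
    rintro a b h e (⟨k, i, hk, rfl⟩ | ⟨k, i, x, hk, h1, h2, rfl⟩)
    · exact .inl ⟨k, i, hk, by rw [h k hk]⟩
    · exact .inr ⟨k, i, x, hk, by rwa [← h k hk.le], by rwa [← h (k + 1) hk], rfl⟩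
  exact (key h).antisymm (key fun k hk => (h k hk).symm)

/-- The vertical arcs determine the set of values of `a k`, and a finite set has only one strictly
decreasing enumeration. -/
theorem IsPattern.eq_of_patternArcs_eq {N r : ℕ} {a b : ℕ → Fin r → ℤ} (ha : IsPattern N a)
    (hb : IsPattern N b) (h : patternArcs N a = patternArcs N b) {k : ℕ} (hk : k ≤ N) :
    a k = b k := by
  rw [← StrictAnti.range_inj (ha.strictAnti hk) (hb.strictAnti hk)]
  ext x
  have := vert_mem_patternArcs (N := N) (a := a) (x := x) (k := k)
  rw [h, vert_mem_patternArcs] at this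
  simpa [hk] using this.symm

theorem add_sub_le_of_strictAnti {r : ℕ} {f : Fin r → ℤ} (hf : StrictAnti f) {i j : Fin r}
    (h : i ≤ j) : f j + ((j : ℤ) - i) ≤ f i := by
  have key : ∀ (n : ℕ) (hn : n < r), (i : ℕ) ≤ n → f ⟨n, hn⟩ + ((n : ℤ) - i) ≤ f i := by
    intro n hn hin
    induction n, hin using Nat.le_induction with
    | base => simp
    | succ n hin ih =>
      have h1 := ih (by omega)
      have h2 : f ⟨n + 1, hn⟩ < f ⟨n, by omega⟩ := hf (by simp [Fin.lt_def])
      push_cast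
      omega
  exact key j j.2 h

theorem mem_iff_lt_add_card {S : Finset ℕ} {m : ℕ} (h1 : ∀ j ∈ S, m ≤ j)
    (h2 : ∀ j ∈ S, ∀ i, m ≤ i → i < j → i ∈ S) {j : ℕ} (hj : m ≤ j) :
    j ∈ S ↔ j < m + S.card := by
  constructor
  · intro h
    have hsub : Finset.Icc m j ⊆ S := by
      intro i hi
      rw [Finset.mem_Icc] at hi
      rcases hi.2.eq_or_lt with rfl | hlt
      · exact h
      · exact h2 j h i hi.1 hlt
    have := Finset.card_le_card hsub
    rw [Nat.card_Icc] at this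
    omega
  · intro h
    by_contra hjS
    have hsub : S ⊆ Finset.Ico m j := by
      intro i hi
      rw [Finset.mem_Ico]
      refine ⟨h1 i hi, ?_⟩
      by_contra hji
      rcases (not_lt.1 hji).eq_or_lt with rfl | hlt
      · exact hjS hi
      · exact hjS (h2 i hi j hj hlt)
    have := Finset.card_le_card hsub
    rw [Nat.card_Ico] at this
    omega

namespace SkewShape

variable {α : SkewShape} {N : ℕ}

theorem mem_cells {i j : ℕ} :
    (i, j) ∈ α.cells ↔ α.inner.rowLen i ≤ j ∧ j < α.outer.rowLen i := by
  rw [cells, Finset.mem_sdiff, YoungDiagram.mem_cells, YoungDiagram.mem_cells,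
    YoungDiagram.mem_iff_lt_rowLen, YoungDiagram.mem_iff_lt_rowLen]
  omega

theorem inner_le_outer (α : SkewShape) (i : ℕ) : α.inner.rowLen i ≤ α.outer.rowLen i := by
  by_contra h
  have h1 : (i, α.outer.rowLen i) ∈ α.inner := YoungDiagram.mem_iff_lt_rowLen.2 (by omega)
  have h2 := YoungDiagram.mem_iff_lt_rowLen.1 (α.le h1)
  omega

theorem lt_length {i j : ℕ} (h : (i, j) ∈ α.cells) : i < α.length := by
  rw [length, ← YoungDiagram.mem_iff_lt_colLen, YoungDiagram.mem_iff_lt_rowLen]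
  have := mem_cells.1 h
  omega

open Classical in
/-- In row `i`, the entries smaller than `k` (for the letters `0, …, N - 1`) are those to the left of
this column. -/
noncomputable def boundary (α : SkewShape) (T : {c // c ∈ α.cells} → Fin N) (k i : ℕ) : ℕ :=
  α.inner.rowLen i + (Finset.univ.filter fun c => c.1.1 = i ∧ (T c : ℕ) < k).card

variable {T : {c // c ∈ α.cells} → Fin N}

/-- Rows increase weakly, so the entries smaller than `k` fill an initial segment of the row, and
its cardinality gives its right end. -/
theorem lt_boundary_iff (hT : α.IsSemistandard N T) {k i j : ℕ} (h : (i, j) ∈ α.cells) :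
    j < α.boundary T k i ↔ (T ⟨(i, j), h⟩ : ℕ) < k := by
  classical
  have hcard : (Finset.univ.filter fun c : {c // c ∈ α.cells} => c.1.1 = i ∧ (T c : ℕ) < k).card =
      ((Finset.univ.filter fun c : {c // c ∈ α.cells} =>
        c.1.1 = i ∧ (T c : ℕ) < k).image fun c => c.1.2).card := by
    rw [Finset.card_image_of_injOn]
    rintro ⟨⟨i1, j1⟩, h1⟩ hc ⟨⟨i2, j2⟩, h2⟩ hd heq
    simp only [Finset.coe_filter, Finset.mem_univ, true_and, Set.mem_ofPred_eq] at hc hd heq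
    obtain ⟨rfl, -⟩ := hc
    obtain ⟨rfl, -⟩ := hd
    subst heq
    rfl
  have hmem : ∀ j, j ∈ ((Finset.univ.filter fun c : {c // c ∈ α.cells} =>
      c.1.1 = i ∧ (T c : ℕ) < k).image fun c => c.1.2) ↔
        ∃ h : (i, j) ∈ α.cells, (T ⟨(i, j), h⟩ : ℕ) < k := by
    intro j
    simp only [Finset.mem_image, Finset.mem_filter, Finset.mem_univ, true_and]
    constructor
    · rintro ⟨⟨⟨i', j'⟩, hc⟩, ⟨rfl, h'⟩, rfl⟩
      exact ⟨hc, h'⟩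
    · rintro ⟨h, h'⟩
      exact ⟨⟨(i, j), h⟩, ⟨rfl, h'⟩, rfl⟩
  rw [boundary, hcard, ← mem_iff_lt_add_card _ _ (mem_cells.1 h).1, hmem]
  · exact ⟨fun ⟨_, h'⟩ => h', fun h' => ⟨h, h'⟩⟩
  · intro j hj
    obtain ⟨hj, -⟩ := (hmem j).1 hj
    exact (mem_cells.1 hj).1
  · intro j hj j' h1 h2
    obtain ⟨hj, hjk⟩ := (hmem j).1 hj
    have hj' : (i, j') ∈ α.cells := mem_cells.2 ⟨h1, h2.trans (mem_cells.1 hj).2⟩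
    have : (T ⟨(i, j'), hj'⟩ : ℕ) ≤ T ⟨(i, j), hj⟩ := hT.1 ⟨(i, j'), hj'⟩ ⟨(i, j), hj⟩ rfl h2
    exact (hmem j').2 ⟨hj', by omega⟩

theorem inner_le_boundary (k i : ℕ) : α.inner.rowLen i ≤ α.boundary T k i := Nat.le_add_right _ _

theorem boundary_mono {k l : ℕ} (h : k ≤ l) (i : ℕ) : α.boundary T k i ≤ α.boundary T l i := by
  classical
  refine Nat.add_le_add_left (Finset.card_le_card ?_) _
  intro c
  simp only [Finset.mem_filter, Finset.mem_univ, true_and]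
  omega

theorem boundary_zero (i : ℕ) : α.boundary T 0 i = α.inner.rowLen i := by
  simp [boundary]

theorem boundary_le (T : {c // c ∈ α.cells} → Fin N) (k i : ℕ) :
    α.boundary T k i ≤ α.outer.rowLen i := by
  classical
  by_contra hlt
  have hsub : ((Finset.univ.filter fun c : {c // c ∈ α.cells} =>
      c.1.1 = i ∧ (T c : ℕ) < k).image fun c => c.1.2) ⊆
        Finset.Ico (α.inner.rowLen i) (α.outer.rowLen i) := by
    intro j hj
    simp only [Finset.mem_image, Finset.mem_filter, Finset.mem_univ, true_and] at hj
    obtain ⟨⟨⟨i', j'⟩, h⟩, ⟨rfl, -⟩, rfl⟩ := hj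
    exact Finset.mem_Ico.2 (mem_cells.1 h)
  have hle := Finset.card_le_card hsub
  rw [Nat.card_Ico, Finset.card_image_of_injOn] at hle
  · have := α.inner_le_outer i
    rw [boundary] at hlt
    omega
  · rintro ⟨⟨i1, j1⟩, h1⟩ hc ⟨⟨i2, j2⟩, h2⟩ hd heq
    simp only [Finset.coe_filter, Finset.mem_univ, true_and, Set.mem_ofPred_eq] at hc hd heq
    obtain ⟨rfl, -⟩ := hc
    obtain ⟨rfl, -⟩ := hd
    subst heq
    rfl

theorem eq_boundary (hT : α.IsSemistandard N T) {k i b : ℕ} (h1 : α.inner.rowLen i ≤ b)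
    (h2 : b ≤ α.outer.rowLen i)
    (h : ∀ j (hj : (i, j) ∈ α.cells), j < b ↔ (T ⟨(i, j), hj⟩ : ℕ) < k) :
    α.boundary T k i = b := by
  have h3 := inner_le_boundary (T := T) k i
  have h4 := boundary_le T k i
  rcases lt_trichotomy (α.boundary T k i) b with hlt | heq | hlt
  · have hc : (i, α.boundary T k i) ∈ α.cells := mem_cells.2 ⟨h3, by omega⟩
    exact absurd ((lt_boundary_iff hT hc).2 ((h _ hc).1 hlt)) (lt_irrefl _)
  · exact heq
  · have hc : (i, b) ∈ α.cells := mem_cells.2 ⟨h1, by omega⟩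
    exact absurd ((h _ hc).2 ((lt_boundary_iff hT hc).1 hlt)) (lt_irrefl _)

theorem boundary_top (hT : α.IsSemistandard N T) (i : ℕ) :
    α.boundary T N i = α.outer.rowLen i :=
  eq_boundary hT (α.inner_le_outer i) le_rfl fun _ hj =>
    ⟨fun _ => (T _).2, fun _ => (mem_cells.1 hj).2⟩

/-- The pattern of a tableau. -/
noncomputable def pattern (α : SkewShape) (r : ℕ) (t : ℤ) (T : {c // c ∈ α.cells} → Fin N) (k : ℕ)
    (i : Fin r) : ℤ := α.boundary T k i - (i + 1) + t

/-- The inequality between different paths expresses that columns increase strictly. -/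
theorem isPattern (hT : α.IsSemistandard N T) (r : ℕ) (t : ℤ) : IsPattern N (α.pattern r t T) := by
  refine ⟨?_, ?_, ?_⟩
  · intro i j hij
    simp only [pattern, boundary_zero]
    have := α.inner.rowLen_anti i j hij.le
    rw [Fin.lt_def] at hij
    omega
  · intro k _ i
    simp only [pattern]
    have := boundary_mono (α := α) (T := T) (show k ≤ k + 1 by omega) i
    omega
  · intro k _ i j hij
    rw [Fin.lt_def] at hij
    simp only [pattern]
    by_contra hle
    have h1 := boundary_le T (k + 1) j
    have h2 := boundary_le T k i
    have h3 := inner_le_boundary (T := T) k i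
    have h4 := α.outer.rowLen_anti i j hij.le
    have h5 := α.inner.rowLen_anti i j hij.le
    -- If the inequality failed, column `p` would contain an entry at least `k` in row `i`, as it is
    -- not left of the boundary there, and an entry at most `k` in the lower row `j`.
    obtain ⟨p, hp⟩ : ∃ p, p + 1 + i = α.boundary T k i + j :=
      ⟨α.boundary T k i + j - i - 1, by omega⟩
    have hc1 : ((i : ℕ), α.boundary T k i) ∈ α.cells := mem_cells.2 (by omega)
    have hc2 : ((i : ℕ), p) ∈ α.cells := mem_cells.2 (by omega)
    have hc3 : ((j : ℕ), p) ∈ α.cells := mem_cells.2 (by omega)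
    have e1 : k ≤ T ⟨_, hc1⟩ := by
      by_contra hlt
      exact lt_irrefl _ ((lt_boundary_iff hT hc1).2 (not_le.1 hlt))
    have e2 : (T ⟨_, hc3⟩ : ℕ) < k + 1 := (lt_boundary_iff hT hc3).1 (by omega)
    have e3 : (T ⟨_, hc2⟩ : ℕ) < T ⟨_, hc3⟩ := hT.2 ⟨_, hc2⟩ ⟨_, hc3⟩ rfl hij
    have e4 : (T ⟨_, hc1⟩ : ℕ) ≤ T ⟨_, hc2⟩ := by
      rcases (show α.boundary T k i ≤ p by omega).eq_or_lt with h | h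
      · simp only [← h, le_refl]
      · exact hT.1 ⟨_, hc1⟩ ⟨_, hc2⟩ rfl h
    omega

theorem inl_mem_points {r : ℕ} {t x : ℤ} :
    Sum.inl x ∈ α.points r t ↔ ∃ i : Fin r, (α.inner.rowLen i : ℤ) - (i + 1) + t = x := by
  simp [points, Fin.exists_iff]

theorem inr_mem_points {r : ℕ} {t x : ℤ} :
    Sum.inr x ∈ α.points r t ↔ ∃ i : Fin r, (α.outer.rowLen i : ℤ) - (i + 1) + t = x := by
  simp [points, Fin.exists_iff]

theorem isFlowOn_pattern (hT : α.IsSemistandard N T) (r : ℕ) (t : ℤ) :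
    IsFlowOn N (α.points r t) (patternArcs N (α.pattern r t T)) := by
  refine (isPattern hT r t).isFlowOn ?_ ?_
  · intro x
    simp only [inl_mem_points, pattern, boundary_zero]
  · intro x
    simp only [inr_mem_points, pattern, boundary_top hT]

theorem injOn_pattern {r : ℕ} (hr : α.length ≤ r) (t : ℤ) :
    Set.InjOn (fun T => patternArcs N (α.pattern r t T)) {T | α.IsSemistandard N T} := by
  intro T hT T' hT' h
  have heq := fun k (hk : k ≤ N) => (isPattern hT r t).eq_of_patternArcs_eq (isPattern hT' r t) h hk
  funext ⟨⟨i, j⟩, hc⟩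
  have hi : i < r := (lt_length hc).trans_le hr
  have key : ∀ k ≤ N, (T ⟨_, hc⟩ : ℕ) < k ↔ (T' ⟨_, hc⟩ : ℕ) < k := by
    intro k hk
    rw [← lt_boundary_iff hT, ← lt_boundary_iff hT']
    have := congrFun (heq k hk) ⟨i, hi⟩
    simp only [pattern] at this
    omega
  have h1 := key (T ⟨_, hc⟩ + 1) (T ⟨_, hc⟩).2
  have h2 := key (T' ⟨_, hc⟩ + 1) (T' ⟨_, hc⟩).2
  ext
  omega

/-- The entry of a cell is the level `l` at which the path of its row passes over the shifted
content `j - (i + 1) + t` of the cell, that is, `a l i ≤ j - (i + 1) + t < a (l + 1) i`. -/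
theorem surjOn_pattern {r : ℕ} (hr : α.length ≤ r) (t : ℤ) :
    Set.SurjOn (fun T => patternArcs N (α.pattern r t T)) {T | α.IsSemistandard N T}
      {A | IsFlowOn N (α.points r t) A} := by
  intro A hA
  have hs : StrictAnti fun i : Fin r => (α.inner.rowLen i : ℤ) - (i + 1) + t := by
    intro i j hij
    have := α.inner.rowLen_anti i j hij.le
    rw [Fin.lt_def] at hij
    simp only
    omega
  have hs' : StrictAnti fun i : Fin r => (α.outer.rowLen i : ℤ) - (i + 1) + t := by
    intro i j hij
    have := α.outer.rowLen_anti i j hij.le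
    rw [Fin.lt_def] at hij
    simp only
    omega
  obtain ⟨a, ha0, ha, rfl⟩ := hA.exists_pattern hs fun x => by
    rw [← inl_mem_points, ← hA.stub_mem]
    simp [stub, vert]
  have haN : a N = fun i : Fin r => (α.outer.rowLen i : ℤ) - (i + 1) + t := by
    rw [← StrictAnti.range_inj (ha.strictAnti le_rfl) hs']
    ext x
    rw [Set.mem_range, Set.mem_range, ← inr_mem_points, ← hA.stub_mem,
      show stub N (Sum.inr x) = vert x (N : ℕ) by simp [stub, vert], vert_mem_patternArcs]
    simp
  have hmono : ∀ k l, k ≤ l → l ≤ N → ∀ i, a k i ≤ a l i := by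
    intro k l hkl
    induction l, hkl using Nat.le_induction with
    | base => exact fun _ _ => le_rfl
    | succ l _ ih => exact fun hl i => (ih (by omega) i).trans (ha.le l hl i)
  have hrow : ∀ c : {c // c ∈ α.cells}, c.1.1 < r := fun c => (lt_length c.2).trans_le hr
  have hex : ∀ c : {c // c ∈ α.cells}, ∃ l : Fin N,
      a l ⟨c.1.1, hrow c⟩ ≤ (c.1.2 : ℤ) - (c.1.1 + 1) + t ∧
        (c.1.2 : ℤ) - (c.1.1 + 1) + t < a (l + 1) ⟨c.1.1, hrow c⟩ := by
    intro c
    have hc : α.inner.rowLen c.1.1 ≤ c.1.2 ∧ c.1.2 < α.outer.rowLen c.1.1 := mem_cells.1 c.2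
    have hP : ∃ k, k ≤ N ∧ (c.1.2 : ℤ) - (c.1.1 + 1) + t < a k ⟨c.1.1, hrow c⟩ :=
      ⟨N, le_rfl, by rw [haN]; simp only; omega⟩
    classical
    -- The first level beyond the content is not `0`, since the cell lies outside the inner shape;
    -- the entry is its predecessor.
    obtain ⟨h1, h2⟩ := Nat.find_spec hP
    have h3 : Nat.find hP ≠ 0 := by
      intro h0
      rw [h0, ha0] at h2
      simp only at h2
      omega
    obtain ⟨l, hl⟩ := Nat.exists_eq_succ_of_ne_zero h3
    have h4 := Nat.find_min hP (m := l) (by omega)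
    rw [hl] at h1 h2
    refine ⟨⟨l, h1⟩, ?_, h2⟩
    by_contra hlt
    exact h4 ⟨by omega, by simpa using hlt⟩
  choose T hT1 hT2 using hex
  have hlt : ∀ (c : {c // c ∈ α.cells}) (k : ℕ), k ≤ N →
      ((c.1.2 : ℤ) - (c.1.1 + 1) + t < a k ⟨c.1.1, hrow c⟩ ↔ (T c : ℕ) < k) := by
    intro c k hk
    constructor
    · intro h
      by_contra hle
      have := hmono k (T c) (by omega) (T c).2.le ⟨c.1.1, hrow c⟩
      have := hT1 c
      omega
    · intro h
      exact (hT2 c).trans_le (hmono _ _ h hk _)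
  have hT : α.IsSemistandard N T := by
    constructor
    · intro c d hrc hcd
      rw [Fin.le_def]
      have h1 := (hlt d (T d + 1) (T d).2).2 (by omega)
      have h2 := (hlt c (T d + 1) (T d).2).1 (by
        have : (⟨c.1.1, hrow c⟩ : Fin r) = ⟨d.1.1, hrow d⟩ := Fin.ext hrc
        rw [this]
        omega)
      omega
    · intro c d hcol hcd
      rw [Fin.lt_def]
      by_contra hle
      have h1 := hT2 d
      have h2 := hT1 c
      have h3 := hmono (T d) (T c) (by omega) (T c).2.le ⟨c.1.1, hrow c⟩
      have hi : c.1.1 + 1 < r := by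
        have := hrow d
        omega
      have h4 := ha.lt (T d) (T d).2 ⟨c.1.1, hrow c⟩ ⟨c.1.1 + 1, hi⟩ (by simp [Fin.lt_def])
      -- Rows `c` and `d` need not be adjacent: `h4` compares row `c` with the next one, and strict
      -- decrease makes up for the remaining difference of contents down to row `d`.
      have h5 := add_sub_le_of_strictAnti (ha.strictAnti (k := T d + 1) (T d).2)
        (i := ⟨c.1.1 + 1, hi⟩) (j := ⟨d.1.1, hrow d⟩) (by simpa [Fin.le_def] using hcd)
      push_cast at h5
      omega
  refine ⟨T, hT, patternArcs_congr fun k hk => ?_⟩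
  funext i
  have h0 := hmono 0 k (by omega) hk i
  have hN := hmono k N hk le_rfl i
  simp only [ha0, haN] at h0 hN
  obtain ⟨b, hb⟩ : ∃ b : ℕ, (b : ℤ) = a k i + (i + 1) - t :=
    ⟨(a k i + (i + 1) - t).toNat, by omega⟩
  rw [pattern, eq_boundary hT (b := b) (by omega) (by omega)]
  · omega
  · intro j hj
    rw [← hlt _ k hk]
    simp only [Fin.eta]
    omega

/-- Cells with entry `k` correspond to horizontal arcs on height `k + 1`, the shifted content of the
cell being the abscissa of the tail. -/
theorem weight_pattern (hT : α.IsSemistandard N T) {r : ℕ} (hr : α.length ≤ r) (t : ℤ) :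
    weight N (patternArcs N (α.pattern r t T)) =
      ∏ k : Fin N, MvPolynomial.X k ^ (Finset.univ.filter fun c => T c = k).card := by
  classical
  refine Finset.prod_congr rfl fun k _ => ?_
  congr 1
  have hrow : ∀ c : {c // c ∈ α.cells}, c.1.1 < r := fun c => (lt_length c.2).trans_le hr
  have himg : patternArcs N (α.pattern r t T) ∩ {e | ∃ x, e = hor x ((k : ℤ) + 1)} =
      (fun c : {c // c ∈ α.cells} => hor ((c.1.2 : ℤ) - (c.1.1 + 1) + t) ((k : ℤ) + 1)) ''
        (Finset.univ.filter fun c => T c = k : Finset _) := by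
    ext e
    simp only [Set.mem_inter_iff, Set.mem_ofPred_eq, Finset.coe_filter, Finset.mem_univ, true_and,
      Set.mem_image]
    constructor
    · rintro ⟨he, x, rfl⟩
      obtain ⟨hk, i, h1, h2⟩ := hor_mem_patternArcs.1 he
      simp only [pattern] at h1 h2
      have h3 := inner_le_boundary (T := T) k i
      have h4 := boundary_le T (k + 1) i
      obtain ⟨j, hj⟩ : ∃ j : ℕ, (j : ℤ) = x + (i + 1) - t := ⟨(x + (i + 1) - t).toNat, by omega⟩
      have hc : ((i : ℕ), j) ∈ α.cells := mem_cells.2 (by omega)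
      have h5 := lt_boundary_iff hT (k := k) hc
      have h6 := lt_boundary_iff hT (k := k + 1) hc
      refine ⟨⟨_, hc⟩, ?_, ?_⟩
      · have h7 : ¬ (T ⟨_, hc⟩ : ℕ) < k := fun h => by
          have := h5.2 h
          omega
        have h8 : (T ⟨_, hc⟩ : ℕ) < k + 1 := h6.1 (by omega)
        exact Fin.ext (le_antisymm (Nat.lt_succ_iff.1 h8) (not_lt.1 h7))
      · refine hor_inj.2 ⟨?_, rfl⟩
        show (j : ℤ) - ((i : ℕ) + 1) + t = x
        omega
    · rintro ⟨⟨⟨i, j⟩, hc⟩, rfl, rfl⟩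
      refine ⟨hor_mem_patternArcs.2 ⟨(T _).2, ⟨i, hrow ⟨_, hc⟩⟩, ?_⟩, _, rfl⟩
      have h5 := lt_boundary_iff hT (k := T ⟨_, hc⟩) hc
      have h6 := lt_boundary_iff hT (k := T ⟨_, hc⟩ + 1) hc
      simp only [pattern]
      omega
  rw [himg, Set.InjOn.ncard_image, Set.ncard_coe_finset]
  rintro ⟨⟨i, j⟩, hc⟩ hcT ⟨⟨i', j'⟩, hc'⟩ hcT' h
  simp only [Finset.coe_filter, Finset.mem_univ, true_and, Set.mem_ofPred_eq, hor_inj] at hcT hcT' h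
  have h1 := lt_boundary_iff hT (k := k) hc
  have h2 := lt_boundary_iff hT (k := k + 1) hc
  have h3 := lt_boundary_iff hT (k := k) hc'
  have h4 := lt_boundary_iff hT (k := k + 1) hc'
  rw [hcT] at h1 h2
  rw [hcT'] at h3 h4
  have hij : (⟨i, hrow ⟨_, hc⟩⟩ : Fin r) = ⟨i', hrow ⟨_, hc'⟩⟩ := by
    refine (isPattern hT r t).eq_of_mem_interval k.2 (x := (j : ℤ) - (i + 1) + t) ?_ ?_ ?_ ?_ <;>
      simp only [pattern] <;> omega
  obtain rfl : i = i' := congrArg Fin.val hij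
  obtain rfl : j = j' := by omega
  rfl

theorem bijOn_pattern {r : ℕ} (hr : α.length ≤ r) (t : ℤ) :
    Set.BijOn (fun T => patternArcs N (α.pattern r t T)) {T | α.IsSemistandard N T}
      {A | IsFlowOn N (α.points r t) A} :=
  ⟨fun _ hT => isFlowOn_pattern hT r t, injOn_pattern hr t, surjOn_pattern hr t⟩

theorem CorrespondsTo.finite {Q : Finset Point} (h : α.CorrespondsTo Q) :
    {A | IsFlowOn N Q A}.Finite := by
  obtain ⟨r, t, hr, rfl⟩ := h
  rw [← (bijOn_pattern hr t).image_eq]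
  exact (Set.toFinite _).image _

/-- The right-hand side involves only `Q`, so the choice of the shape, of the shift and of the
number of rows does not matter. -/
theorem CorrespondsTo.schur_eq {Q : Finset Point} (h : α.CorrespondsTo Q) :
    α.schur N = ∑ᶠ A ∈ {A | IsFlowOn N Q A}, weight N A := by
  classical
  obtain ⟨r, t, hr, rfl⟩ := h
  rw [schur, ← finsum_mem_coe_finset]
  refine finsum_mem_eq_of_bijOn (fun T => patternArcs N (α.pattern r t T)) ?_ ?_
  · simpa using bijOn_pattern hr t
  · intro T hT
    rw [weight_pattern (by simpa using hT) hr t]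

end SkewShape

/-! ### Skew shapes from starting and ending points -/

theorem exists_youngDiagram {r : ℕ} {f : ℕ → ℕ} (hf : Antitone f) (hr : f r = 0) :
    ∃ μ : YoungDiagram, (∀ i, μ.rowLen i = f i) ∧ μ.colLen 0 ≤ r := by
  have hlt : ∀ {i j}, j < f i → i < r := by
    intro i j h
    by_contra hle
    have := hf (not_lt.1 hle)
    omega
  let μ : YoungDiagram :=
    { cells := (Finset.range r).biUnion fun i => (Finset.range (f i)).image fun j => (i, j)
      isLowerSet := by
        rintro ⟨i, j⟩ ⟨i', j'⟩ hle h
        simp only [Finset.coe_biUnion, Finset.coe_range, Finset.coe_image, Set.mem_iUnion,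
          Set.mem_image, Set.mem_Iio, Prod.mk.injEq] at h ⊢
        obtain ⟨a, ha, b, hb, rfl, rfl⟩ := h
        have h1 : i' ≤ a := hle.1
        have h2 : j' ≤ b := hle.2
        exact ⟨i', by omega, j', by have := hf h1; omega, rfl, rfl⟩ }
  have hmem : ∀ i j, (i, j) ∈ μ ↔ j < f i := by
    intro i j
    rw [← YoungDiagram.mem_cells]
    simp only [μ, Finset.mem_biUnion, Finset.mem_range, Finset.mem_image, Prod.mk.injEq]
    constructor
    · rintro ⟨a, ha, b, hb, rfl, rfl⟩
      exact hb
    · exact fun h => ⟨i, hlt h, j, h, rfl, rfl⟩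
  refine ⟨μ, fun i => ?_, ?_⟩
  · refine le_antisymm ?_ ?_ <;> by_contra h
    · have := (hmem i (f i)).1 (YoungDiagram.mem_iff_lt_rowLen.2 (by omega))
      omega
    · have := YoungDiagram.mem_iff_lt_rowLen.1 ((hmem i (μ.rowLen i)).2 (by omega))
      omega
  · by_contra h
    have := (hmem r 0).1 (YoungDiagram.mem_iff_lt_colLen.2 (by omega))
    omega

theorem exists_youngDiagram_of_strictAnti {r : ℕ} {f : Fin r → ℤ} (hf : StrictAnti f) {t : ℤ}
    (ht : ∀ i, 0 ≤ f i + (i + 1) - t) :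
    ∃ μ : YoungDiagram, (∀ i : Fin r, (μ.rowLen i : ℤ) = f i + (i + 1) - t) ∧
      (∀ i, r ≤ i → μ.rowLen i = 0) ∧ μ.colLen 0 ≤ r := by
  obtain ⟨μ, h1, h2⟩ := exists_youngDiagram (r := r)
    (f := fun i => if h : i < r then (f ⟨i, h⟩ + (i + 1) - t).toNat else 0) (by
      intro i j hij
      simp only
      split_ifs with hj hi
      · have := add_sub_le_of_strictAnti hf (i := ⟨i, hi⟩) (j := ⟨j, hj⟩) hij
        simp only at this
        omega
      · omega
      · exact Nat.zero_le _
      · exact le_rfl) (by simp)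
  refine ⟨μ, fun i => ?_, fun i hi => ?_, h2⟩
  · rw [h1, dif_pos i.2]
    exact Int.toNat_of_nonneg (ht i)
  · rw [h1, dif_neg (by omega)]

/-- The shift is a lower bound of the starting points, which makes all parts nonnegative. The inner
shape is contained in the outer one because paths never go to the left. -/
theorem PathFamily.exists_correspondsTo {N : ℕ} {Q : Finset Point} (F : PathFamily N Q) :
    ∃ ρ : SkewShape, ρ.CorrespondsTo Q := by
  have hle : ∀ i, F.start i ≤ F.finish i := fun i =>
    ((F.isPath i).bounds (List.mem_of_mem_head? (F.isPath i).2.1)).2.1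
  obtain ⟨m, hm⟩ := (Set.finite_range F.start).bddBelow
  have hm : ∀ i, m ≤ F.start i := fun i => hm ⟨i, rfl⟩
  obtain ⟨μ, h1, h2, -⟩ := exists_youngDiagram_of_strictAnti F.start_anti (t := m)
    fun i => by have := hm i; omega
  obtain ⟨l, h3, h4, h5⟩ := exists_youngDiagram_of_strictAnti F.finish_anti (t := m)
    fun i => by have := hm i; have := hle i; omega
  refine ⟨⟨l, μ, ?_⟩, F.r, m, h5, ?_⟩
  · rintro ⟨i, j⟩ hij
    rw [YoungDiagram.mem_iff_lt_rowLen] at hij ⊢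
    by_cases hi : i < F.r
    · have e1 := h1 ⟨i, hi⟩
      have e2 := h3 ⟨i, hi⟩
      have := hle ⟨i, hi⟩
      simp only at e1 e2
      omega
    · rw [h2 i (by omega)] at hij
      omega
  · ext (x | x)
    · rw [SkewShape.inl_mem_points, F.mem_start]
      refine exists_congr fun i => ?_
      rw [h1 i]
      constructor <;> intro <;> omega
    · rw [SkewShape.inr_mem_points, F.mem_finish]
      refine exists_congr fun i => ?_
      rw [h3 i]
      constructor <;> intro <;> omega

/-! ### Points and colours -/

theorem radialOf_inj {q : Point} {c d : Colour} : radialOf q c = radialOf q d ↔ c = d := by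
  rcases q with x | x <;> cases c <;> cases d <;> simp [radialOf]

theorem exists_radialOf_eq (q : Point) (ρ : Radial) : ∃ c, radialOf q c = ρ := by
  rcases q with x | x <;> cases ρ
  · exact ⟨.black, rfl⟩
  · exact ⟨.white, rfl⟩
  · exact ⟨.white, rfl⟩
  · exact ⟨.black, rfl⟩

section

variable {N : ℕ} {K : Configuration} {v : Orientation K}

theorem mem_points {c : Colour} {q : Point} :
    q ∈ v.points c ↔ q ∈ K.doubled ∨ ∃ h : q ∈ K.coloured, radialOf q c = v ⟨q, h⟩ := by
  simp [Orientation.points]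

theorem mem_points_of_coloured (hK : Disjoint K.doubled K.coloured) {c : Colour}
    (q : {q // q ∈ K.coloured}) : q.1 ∈ v.points c ↔ radialOf q.1 c = v q := by
  have : q.1 ∉ K.doubled := fun h => Finset.disjoint_left.1 hK h q.2
  rw [mem_points]
  simp [this]

/-- A coloured point belongs to some path, and this path climbs from height `1` to height `N`. -/
theorem Overlay.one_le (P : Overlay N v) (q : {q // q ∈ K.coloured}) : 1 ≤ N := by
  obtain ⟨c, hc⟩ := exists_radialOf_eq q.1 (v q)
  have hq : q.1 ∈ v.points c := mem_points.2 (.inr ⟨q.2, hc⟩)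
  have hi : Nonempty (Fin (P c).r) := by
    rcases h : q.1 with x | x <;> rw [h] at hq
    · obtain ⟨i, -⟩ := ((P c).mem_start x).1 hq
      exact ⟨i⟩
    · obtain ⟨i, -⟩ := ((P c).mem_finish x).1 hq
      exact ⟨i⟩
  obtain ⟨i⟩ := hi
  have h := (P c).isPath i
  have := (h.bounds (List.mem_of_mem_head? h.2.1)).2.2
  simpa using this

/-! ### Admissibility -/

/-- Starting points count positively, ending points negatively. -/
def pointSign : Point → ℤ := Sum.elim (fun _ => 1) fun _ => -1

theorem PathFamily.sum_pointSign {Q : Finset Point} (F : PathFamily N Q) :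
    ∑ q ∈ Q, pointSign q = 0 := by
  have h1 : Q.toLeft = Finset.univ.image F.start := by
    ext x
    simp [F.mem_start]
  have h2 : Q.toRight = Finset.univ.image F.finish := by
    ext x
    simp [F.mem_finish]
  rw [← Finset.toLeft_disjSum_toRight (u := Q), Finset.sum_disjSum, h1, h2,
    Finset.sum_image F.start_anti.injective.injOn, Finset.sum_image F.finish_anti.injective.injOn]
  simp [pointSign]

/-- In the difference of the white and the black sum the doubled points cancel, while an outward
point counts `1` and an inward point `-1`, whether it is a starting or an ending point. -/
theorem admissible_of_sum_eq_zero (hK : Disjoint K.doubled K.coloured)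
    (h : ∀ c, ∑ q ∈ v.points c, pointSign q = 0) : Admissible v := by
  have hsum : ∀ c, ∑ q ∈ K.doubled, pointSign q +
      ∑ q : {q // q ∈ K.coloured}, (if radialOf q.1 c = v q then pointSign q.1 else 0) = 0 := by
    intro c
    refine Eq.trans ?_ (h c)
    rw [Orientation.points, Finset.sum_union, Finset.sum_map, Finset.sum_filter]
    · rfl
    · rw [Finset.disjoint_left]
      intro q hq hq'
      obtain ⟨p, -, rfl⟩ := Finset.mem_map.1 hq'
      exact Finset.disjoint_left.1 hK hq p.2
  have hdiff : ∑ q : {q // q ∈ K.coloured}, ((if v q = .outward then 1 else 0) -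
      (if v q = .inward then 1 else 0) : ℤ) = 0 := by
    have h1 := hsum .white
    have h2 := hsum .black
    have h3 : ∀ q : {q // q ∈ K.coloured}, ((if v q = .outward then 1 else 0) -
        (if v q = .inward then 1 else 0) : ℤ) =
        (if radialOf q.1 .white = v q then pointSign q.1 else 0) -
          (if radialOf q.1 .black = v q then pointSign q.1 else 0) := by
      rintro ⟨x | x, hx⟩ <;> rcases v ⟨_, hx⟩ with _ | _ <;> simp [radialOf, pointSign]
    rw [Finset.sum_congr rfl fun q _ => h3 q, Finset.sum_sub_distrib]
    omega
  rw [Finset.sum_sub_distrib, Finset.sum_boole, Finset.sum_boole] at hdiff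
  rw [Admissible]
  omega

/-! ### Overlays as pairs of flows -/

/-- `A` is a pair of flows for the white and the black points determined by `v`. -/
def IsOverlayFlow (N : ℕ) {K : Configuration} (v : Orientation K) (A : Colour → Set Arc) : Prop :=
  ∀ c, IsFlowOn N (v.points c) (A c)

theorem exists_strictAnti_range (s : Finset ℤ) :
    ∃ f : Fin s.card → ℤ, StrictAnti f ∧ ∀ x, x ∈ s ↔ ∃ i, f i = x := by
  refine ⟨fun i => s.orderEmbOfFin rfl i.rev, fun i j h => ?_, fun x => ?_⟩
  · exact (s.orderEmbOfFin rfl).strictMono (Fin.rev_lt_rev.2 h)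
  · have := congrArg (x ∈ ·) (s.range_orderEmbOfFin rfl)
    simp only [Set.mem_range, Finset.mem_coe, eq_iff_iff] at this
    rw [← this]
    exact ⟨fun ⟨i, hi⟩ => ⟨i.rev, by simpa using hi⟩, fun ⟨i, hi⟩ => ⟨i.rev, hi⟩⟩

theorem IsFlowOn.exists_pathFamily (hN : 1 ≤ N) {Q : Finset Point} {A : Set Arc}
    (hA : IsFlowOn N Q A) : ∃ F : PathFamily N Q, F.arcs = A := by
  obtain ⟨s, hs, hs'⟩ := exists_strictAnti_range Q.toLeft
  have hs0 : ∀ x, Sum.inl x ∈ Q ↔ ∃ i, s i = x := fun x => by rw [← hs', Finset.mem_toLeft]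
  obtain ⟨a, rfl, ha, rfl⟩ := hA.exists_pattern hs fun x => by
    rw [← hs0, ← hA.stub_mem]
    simp [stub, vert]
  refine ha.exists_pathFamily hN hs0 fun x => ?_
  rw [← hA.stub_mem, show stub N (Sum.inr x) = vert x (N : ℕ) by simp [stub, vert],
    vert_mem_patternArcs]
  simp

theorem IsOverlayFlow.exists_overlay (hN : 1 ≤ N) {A : Colour → Set Arc}
    (hA : IsOverlayFlow N v A) : ∃ P : Overlay N v, (fun c => (P c).arcs) = A := by
  choose P hP using fun c => (hA c).exists_pathFamily hN
  exact ⟨P, funext hP⟩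

theorem Overlay.isOverlayFlow (hN : 1 ≤ N) (P : Overlay N v) :
    IsOverlayFlow N v fun c => (P c).arcs := fun c => (P c).isFlowOn_arcs hN

theorem IsOverlayFlow.stubs_coloured (hK : Disjoint K.doubled K.coloured) {A : Colour → Set Arc}
    (hA : IsOverlayFlow N v A) (S : Set {q // q ∈ K.coloured}) :
    ∀ e ∈ stubs N S, e ∈ allArcs A ∧ e ∉ commonArcs A := by
  rintro _ ⟨q, -, rfl⟩
  constructor
  · obtain ⟨c, hc⟩ := exists_radialOf_eq q.1 (v q)
    exact ⟨c, ((hA c).stub_mem _).2 ((mem_points_of_coloured hK q).2 hc)⟩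
  · intro h
    have h1 := (mem_points_of_coloured hK q).1 (((hA .white).stub_mem _).1 (h .white))
    have h2 := (mem_points_of_coloured hK q).1 (((hA .black).stub_mem _).1 (h .black))
    exact absurd (radialOf_inj.1 (h1.trans h2.symm)) (by simp)

/-- The arcs standing for the coloured points reveal their colours. Hence different orientations
have disjoint sets of overlays. -/
theorem IsOverlayFlow.eq {w : Orientation K} (hK : Disjoint K.doubled K.coloured)
    {A : Colour → Set Arc} (hv : IsOverlayFlow N v A) (hw : IsOverlayFlow N w A) : v = w := by
  funext q
  obtain ⟨c, hc⟩ := exists_radialOf_eq q.1 (v q)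
  rw [← hc]
  rw [← mem_points_of_coloured hK, ← (hv c).stub_mem, (hw c).stub_mem,
    mem_points_of_coloured hK] at hc
  exact hc

/-- Recolouring changes the orientation of each point of `S`. -/
theorem IsOverlayFlow.apply_ne {w : Orientation K} (hK : Disjoint K.doubled K.coloured)
    {S : Set {q // q ∈ K.coloured}} {A : Colour → Set Arc} (hv : IsOverlayFlow N v A)
    (hw : IsOverlayFlow N w (recolour N A (stubs N S))) {q : {q // q ∈ K.coloured}} (hq : q ∈ S) :
    v q ≠ w q := by
  intro h
  obtain ⟨c, hc⟩ := exists_radialOf_eq q.1 (v q)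
  have h1 := ((hv c).stub_mem _).2 ((mem_points_of_coloured hK q).2 hc)
  have h2 := ((hw c).stub_mem _).2 ((mem_points_of_coloured hK q).2 (hc.trans h))
  exact (mem_recolour_of_mem (Z := stubs N S) ⟨q, hq, rfl⟩ c).1 h2 h1

/-- Recolouring preserves which points have two colours and which have one, so its result is an
overlay for the same configuration. -/
theorem IsOverlayFlow.exists_recolour (hN : 1 ≤ N) (hK : Disjoint K.doubled K.coloured)
    (S : Set {q // q ∈ K.coloured}) {A : Colour → Set Arc} (hA : IsOverlayFlow N v A) :
    ∃ w : Vertices K, IsOverlayFlow N w.1 (recolour N A (stubs N S)) := by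
  classical
  have hZ := hA.stubs_coloured hK S
  have hall := allArcs_recolour (N := N) hZ
  have hcommon := commonArcs_recolour (N := N) hZ
  have hflow := isFlow_recolour (fun c => (hA c).toIsFlow) hZ
  set A' := recolour N A (stubs N S)
  have hAll : ∀ q, stub N q ∈ allArcs A' ↔ q ∈ K.doubled ∨ q ∈ K.coloured := by
    intro q
    rw [hall]
    constructor
    · rintro ⟨c, hc⟩
      rcases mem_points.1 (((hA c).stub_mem q).1 hc) with h | ⟨h, -⟩
      · exact .inl h
      · exact .inr h
    · rintro (h | h)
      · exact ⟨.white, ((hA _).stub_mem q).2 (mem_points.2 (.inl h))⟩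
      · obtain ⟨c, hc⟩ := exists_radialOf_eq q (v ⟨q, h⟩)
        exact ⟨c, ((hA c).stub_mem _).2 (mem_points.2 (.inr ⟨h, hc⟩))⟩
  have hCommon : ∀ q, stub N q ∈ commonArcs A' ↔ q ∈ K.doubled := by
    intro q
    rw [hcommon]
    constructor
    · intro h
      have h1 := mem_points.1 (((hA .white).stub_mem q).1 (h .white))
      have h2 := mem_points.1 (((hA .black).stub_mem q).1 (h .black))
      rcases h1 with h1 | ⟨hq, h1⟩
      · exact h1
      rcases h2 with h2 | ⟨_, h2⟩
      · exact h2
      exact absurd (radialOf_inj.1 (h1.trans h2.symm)) (by simp)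
    · exact fun h c => ((hA c).stub_mem q).2 (mem_points.2 (.inl h))
  -- The orientation is read off the new colours; the arc of a coloured point has exactly one
  -- colour, so testing for white suffices.
  let w : Orientation K := fun q =>
    radialOf q.1 (if stub N q.1 ∈ A' .white then .white else .black)
  have hw : IsOverlayFlow N w A' := by
    intro c
    refine ⟨hflow c, fun q => ?_⟩
    have h1 := hAll q
    have h2 := hCommon q
    have h3 : q ∈ K.doubled → q ∉ K.coloured := fun h => Finset.disjoint_left.1 hK h
    rw [mem_allArcs .white] at h1
    rw [mem_commonArcs .white] at h2
    rw [mem_points]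
    simp only [w, radialOf_inj]
    by_cases h : stub N q ∈ A' .white <;> cases c <;> simp [h, Colour.other] at h1 h2 ⊢ <;> tauto
  obtain ⟨P, -⟩ := hw.exists_overlay hN
  exact ⟨⟨w, admissible_of_sum_eq_zero hK fun c => (P c).sum_pointSign⟩, hw⟩

/-! ### The recolouring graph -/

variable {S : Set {q // q ∈ K.coloured}}

theorem IsOverlayFlow.adj (hN : 1 ≤ N) (hK : Disjoint K.doubled K.coloured) (hS : S.Nonempty)
    {x y : Vertices K} {A : Colour → Set Arc} (hx : IsOverlayFlow N x.1 A)
    (hy : IsOverlayFlow N y.1 (recolour N A (stubs N S))) : (recolouringGraph N K S).Adj x y := by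
  obtain ⟨q, hq⟩ := hS
  rw [recolouringGraph, SimpleGraph.fromRel_adj]
  refine ⟨fun h => hx.apply_ne hK hy hq (h ▸ rfl), .inl ?_⟩
  obtain ⟨P, hP⟩ := hx.exists_overlay hN
  obtain ⟨P', hP'⟩ := hy.exists_overlay hN
  exact ⟨P, P', (isRecolouring_iff S P P').2 (by rw [hP, hP'])⟩

theorem apply_ne_of_adj (hK : Disjoint K.doubled K.coloured) {x y : Vertices K}
    (h : (recolouringGraph N K S).Adj x y) {q : {q // q ∈ K.coloured}} (hq : q ∈ S) :
    x.1 q ≠ y.1 q := by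
  have key : ∀ x y : Vertices K, (∃ (P : Overlay N x.1) (P' : Overlay N y.1),
      IsRecolouring S P P') → x.1 q ≠ y.1 q := by
    rintro x y ⟨P, P', h⟩
    rw [isRecolouring_iff] at h
    have hN := Overlay.one_le P q
    refine (Overlay.isOverlayFlow hN P).apply_ne hK (S := S) ?_ hq
    rw [← h]
    exact Overlay.isOverlayFlow hN P'
  rw [recolouringGraph, SimpleGraph.fromRel_adj] at h
  rcases h.2 with h | h
  · exact key x y h
  · exact (key y x h).symm

/-- Every edge reverses the orientation of each point of `S`, so the orientation of a single such
point separates the two sides. -/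
theorem isBipartite_recolouringGraph (hK : Disjoint K.doubled K.coloured) (hS : S.Nonempty) :
    (recolouringGraph N K S).IsBipartite := by
  obtain ⟨q, hq⟩ := hS
  refine SimpleGraph.IsBipartiteWith.isBipartite (s := {x | x.1 q = .inward})
    (t := {x | x.1 q = .outward}) ⟨?_, ?_⟩
  · rw [Set.disjoint_left]
    intro x h1 h2
    exact absurd (h1.symm.trans h2) (by simp)
  · intro x y h
    have := apply_ne_of_adj hK h hq
    simp only [Set.mem_ofPred_eq]
    revert this
    rcases x.1 q with _ | _ <;> rcases y.1 q with _ | _ <;> simp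

theorem exists_adj_of_nontrivial {V : Type*} {G : SimpleGraph V} {C : G.ConnectedComponent}
    (hC : C.supp.Nontrivial) {x : V} (hx : x ∈ C.supp) : ∃ y, G.Adj x y := by
  obtain ⟨y, hy, hne⟩ := hC.exists_ne x
  have hxy : G.Reachable x y := SimpleGraph.ConnectedComponent.exact (hx.trans hy.symm)
  obtain ⟨p⟩ := hxy
  cases p with
  | nil => exact absurd rfl hne
  | cons h _ => exact ⟨_, h⟩

theorem exists_overlay_of_adj {x y : Vertices K} (h : (recolouringGraph N K S).Adj x y) :
    Nonempty (Overlay N x.1) := by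
  rw [recolouringGraph, SimpleGraph.fromRel_adj] at h
  rcases h.2 with ⟨P, -, -⟩ | ⟨-, P, -⟩ <;> exact ⟨P⟩

/-! ### Sums over overlays -/

theorem bijOn_overlayFlow (v : Orientation K) :
    Set.BijOn (fun A : Colour → Set Arc => (A .white, A .black)) {A | IsOverlayFlow N v A}
      ({A | IsFlowOn N (v.points .white) A} ×ˢ {A | IsFlowOn N (v.points .black) A}) := by
  refine ⟨fun A hA => ⟨hA _, hA _⟩, fun A _ B _ h => ?_, ?_⟩
  · funext c
    cases c
    · exact congrArg Prod.fst h
    · exact congrArg Prod.snd h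
  · rintro ⟨A, B⟩ ⟨hA, hB⟩
    refine ⟨fun c => match c with | .white => A | .black => B, fun c => ?_, rfl⟩
    cases c
    · exact hA
    · exact hB

theorem CorrespondingPair.finite {ρ : SkewShape × SkewShape} (h : CorrespondingPair v ρ) :
    {A | IsOverlayFlow N v A}.Finite :=
  (bijOn_overlayFlow v).finite_iff_finite.2 (h.1.finite.prod h.2.finite)

theorem CorrespondingPair.schur_mul_schur {ρ : SkewShape × SkewShape}
    (h : CorrespondingPair v ρ) : ρ.1.schur N * ρ.2.schur N =
      ∑ᶠ A ∈ {A | IsOverlayFlow N v A}, weight N (A .white) * weight N (A .black) := by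
  rw [finsum_mem_eq_of_bijOn (g := fun p => weight N p.1 * weight N p.2) _ (bijOn_overlayFlow v)
    fun _ _ => rfl, h.1.schur_eq, h.2.schur_eq]
  have h1 := h.1.finite (N := N)
  have h2 := h.2.finite (N := N)
  rw [← h1.coe_toFinset, ← h2.coe_toFinset, ← Finset.coe_product, finsum_mem_coe_finset,
    finsum_mem_coe_finset, finsum_mem_coe_finset, Finset.sum_mul_sum, Finset.sum_product]

/-- Both sides are sums over overlays. Recolouring leads along an edge, so it stays in `C` and
changes sides; being an involution that preserves weights, it matches the two sums term by term. -/
theorem sum_schur_eq (hN : 1 ≤ N) (hK : Disjoint K.doubled K.coloured) (hS : S.Nonempty)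
    {E O : Set (Vertices K)} (hEO : (recolouringGraph N K S).IsBipartiteWith E O)
    (C : (recolouringGraph N K S).ConnectedComponent) (ρ : Vertices K → SkewShape × SkewShape)
    (hρ : ∀ x ∈ C.supp, CorrespondingPair x.1 (ρ x)) :
    ∑ᶠ x ∈ C.supp ∩ E, (ρ x).1.schur N * (ρ x).2.schur N =
      ∑ᶠ x ∈ C.supp ∩ O, (ρ x).1.schur N * (ρ x).2.schur N := by
  have hunion : ∀ D : Set (Vertices K), ∑ᶠ x ∈ C.supp ∩ D, (ρ x).1.schur N * (ρ x).2.schur N =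
      ∑ᶠ A ∈ ⋃ x ∈ C.supp ∩ D, {A | IsOverlayFlow N x.1 A},
        weight N (A .white) * weight N (A .black) := by
    intro D
    rw [finsum_mem_biUnion _ (Set.toFinite _) fun x hx => (hρ x hx.1).finite]
    · exact finsum_mem_congr rfl fun x hx => (hρ x hx.1).schur_mul_schur
    · intro x _ y _ hxy
      refine Set.disjoint_left.2 fun A hx hy => hxy (Subtype.ext ?_)
      exact IsOverlayFlow.eq hK hx hy
  have hmaps : ∀ {E O : Set (Vertices K)}, (recolouringGraph N K S).IsBipartiteWith E O →
      Set.MapsTo (fun A => recolour N A (stubs N S))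
        (⋃ x ∈ C.supp ∩ E, {A | IsOverlayFlow N x.1 A})
        (⋃ x ∈ C.supp ∩ O, {A | IsOverlayFlow N x.1 A}) := by
    intro E O hEO A hA
    simp only [Set.mem_iUnion] at hA ⊢
    obtain ⟨x, ⟨hxC, hxE⟩, hx⟩ := hA
    obtain ⟨y, hy⟩ := IsOverlayFlow.exists_recolour hN hK S hx
    have hadj := IsOverlayFlow.adj hN hK hS hx hy
    refine ⟨y, ⟨(SimpleGraph.ConnectedComponent.sound hadj.symm.reachable).trans hxC, ?_⟩, hy⟩
    rcases hEO.mem_of_adj hadj with h | h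
    · exact h.2
    · exact (Set.disjoint_left.1 hEO.disjoint hxE h.1).elim
  have hinv : ∀ D : Set (Vertices K), ∀ A ∈ ⋃ x ∈ C.supp ∩ D, {A | IsOverlayFlow N x.1 A},
      recolour N (recolour N A (stubs N S)) (stubs N S) = A := by
    intro D A hA
    simp only [Set.mem_iUnion] at hA
    obtain ⟨x, -, hx⟩ := hA
    exact recolour_recolour (hx.stubs_coloured hK S)
  rw [hunion, hunion]
  refine finsum_mem_eq_of_bijOn (fun A => recolour N A (stubs N S))
    (Set.InvOn.bijOn (f' := fun A => recolour N A (stubs N S)) ⟨hinv E, hinv O⟩ (hmaps hEO) (hmaps hEO.symm)) fun A hA => ?_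
  simp only [Set.mem_iUnion] at hA
  obtain ⟨x, -, hx⟩ := hA
  exact (weight_recolour (fun c => (hx c).toIsFlow) (hx.stubs_coloured hK S)).symm

end

theorem disjoint_configuration (α β : SkewShape) (t : ℤ) :
    Disjoint (configuration α β t).doubled (configuration α β t).coloured := by
  rw [Finset.disjoint_left]
  intro q
  simp only [configuration, Finset.mem_inter, Finset.mem_symmDiff]
  tauto

end SkewOverlay

theorem mainTheorem2 (N : ℕ) (α β : SkewOverlay.SkewShape) (t : ℤ)
    (S : Set {q // q ∈ (SkewOverlay.configuration α β t).coloured})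
    (hS : S.Nonempty)
    (hin : ∀ q ∈ S, SkewOverlay.initialOrientation α β t q = SkewOverlay.Radial.inward) :
    (SkewOverlay.recolouringGraph N (SkewOverlay.configuration α β t) S).IsBipartite ∧
    ∀ E O : Set (SkewOverlay.Vertices (SkewOverlay.configuration α β t)),
      (SkewOverlay.recolouringGraph N (SkewOverlay.configuration α β t) S).IsBipartiteWith E O →
      E ∪ O = Set.univ →
      ∀ C : (SkewOverlay.recolouringGraph N
          (SkewOverlay.configuration α β t) S).ConnectedComponent,
        C.supp.Nontrivial →
        (∀ x ∈ C.supp, ∃ ρ : SkewOverlay.SkewShape × SkewOverlay.SkewShape,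
          SkewOverlay.CorrespondingPair x.1 ρ) ∧
        ∀ ρ : SkewOverlay.Vertices (SkewOverlay.configuration α β t) →
            SkewOverlay.SkewShape × SkewOverlay.SkewShape,
          (∀ x ∈ C.supp, SkewOverlay.CorrespondingPair x.1 (ρ x)) →
          ∑ᶠ x ∈ C.supp ∩ E, (ρ x).1.schur N * (ρ x).2.schur N =
            ∑ᶠ x ∈ C.supp ∩ O, (ρ x).1.schur N * (ρ x).2.schur N := by
  have hK := SkewOverlay.disjoint_configuration α β t
  refine ⟨SkewOverlay.isBipartite_recolouringGraph hK hS, fun E O hEO _ C hC => ?_⟩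
  -- In a component with at least two vertices every vertex lies on an edge, and each end of an edge
  -- has an overlay.
  have hoverlay : ∀ x ∈ C.supp, Nonempty (SkewOverlay.Overlay N x.1) := fun x hx =>
    (SkewOverlay.exists_adj_of_nontrivial hC hx).elim fun _ h =>
      SkewOverlay.exists_overlay_of_adj h
  refine ⟨fun x hx => ?_, fun ρ hρ => ?_⟩
  · obtain ⟨P⟩ := hoverlay x hx
    obtain ⟨ρ₁, h₁⟩ := (P .white).exists_correspondsTo
    obtain ⟨ρ₂, h₂⟩ := (P .black).exists_correspondsTo
    exact ⟨(ρ₁, ρ₂), h₁, h₂⟩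
  · obtain ⟨x, hx⟩ := hC.nonempty
    obtain ⟨P⟩ := hoverlay x hx
    have ⟨q, _⟩ := hS
    exact SkewOverlay.sum_schur_eq (SkewOverlay.Overlay.one_le P q) hK hS hEO C ρ hρ
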